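/- Let $d\ge 2$ and let $\lambda,\mu\in\mathbb R$ satisfy $\mu>0$, $\lambda+2\mu>0$ and $\mu\ne\lambda+2\mu$. Let $\mathcal S(\mathbb R^d)^d$ be the space of $d$-tuples of complex-valued Schwartz functions on $\mathbb R^d$ and let $-\Delta^\ast$ be the Lamé operator $$-\Delta^\ast u=-\mu\Delta u-(\lambda+\mu)\nabla\operatorname{div}u,\qquad u\in\mathcal S(\mathbb R^d)^d .$$ For $z\in\mathbb C\setminus[0,\infty)$ the operator $-\Delta^\ast-z$ is a bijection of $\mathcal S(\mathbb R^d)^d$, and $(-\Delta^\ast-z)^{-1}$ denotes its inverse. For $1\le q\le\infty$ put $\|u\|_{q}=\big(\sum_{j=1}^d\|u_j\|_{L^q(\mathbb R^d)}^q\big)^{1/q}$ if $q<\infty$ and $\|u\|_{\infty}=\max_{1\le j\le d}\|u_j\|_{L^\infty(\mathbb R^d)}$, and for a linear operator $T$ on $\mathcal S(\mathbb R^d)^d$ put $$\|T\|_{p\to q}=\inf\{K\in[0,\infty):\ \|Tf\|_{q}\le K\|f\|_{p}\ \text{ for all } f\in\mathcal S(\mathbb R^d)^d\},\qquad \inf\emptyset=\infty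 .$$ Let $$\mathcal R_0=\begin{cases}\{(x,y)\in[0,1]^2: 0\le x-y<1\}, & d=2,\\[2pt] \{(x,y)\in[0,1]^2: 0\le x-y\le \tfrac2d\}\setminus\{(1,\tfrac{d-2}{d}),(\tfrac2d,0)\}, & d\ge 3.\end{cases}$$ Let $1\le p,q\le\infty$, with the convention $1/\infty=0$. If $(\tfrac1p,\tfrac1q)\notin\mathcal R_0$, then $\|(-\Delta^\ast-z)^{-1}\|_{p\to q}=\infty$ for every $z\in\mathbb C\setminus[0,\infty)$. -/

import Mathlib

open MeasureTheory SchwartzMap FourierTransform LineDeriv Laplacian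
open scoped ENNReal NNReal SchwartzMap

noncomputable section

/-- Euclidean space `ℝ^d`. -/
abbrev RSpace (d : ℕ) : Type := EuclideanSpace ℝ (Fin d)

/-- `𝓢(ℝ^d)^d`: `d`-tuples of complex-valued Schwartz functions on `ℝ^d`. -/
abbrev SchwartzTuple (d : ℕ) : Type := Fin d → 𝓢(RSpace d, ℂ)

/-- The `j`-th partial derivative `∂_j` on `𝓢(ℝ^d)`. -/
def partialD {d : ℕ} (j : Fin d) : 𝓢(RSpace d, ℂ) →ₗ[ℂ] 𝓢(RSpace d, ℂ) :=
  (lineDerivOpCLM ℂ 𝓢(RSpace d, ℂ) (EuclideanSpace.single j (1 : ℝ))).toLinearMap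

/-- The divergence `div u = ∑ k, ∂_k u_k` of a tuple of Schwartz functions. -/
def divergence {d : ℕ} : SchwartzTuple d →ₗ[ℂ] 𝓢(RSpace d, ℂ) :=
  ∑ k : Fin d, partialD k ∘ₗ LinearMap.proj k

/-- The operator `-Δ* u = -μ Δ u - (λ + μ) ∇ div u` on `𝓢(ℝ^d)^d` (with `lam` for `λ`); the
Laplacian acts componentwise. -/
def negLame (d : ℕ) (lam μ : ℝ) : SchwartzTuple d →ₗ[ℂ] SchwartzTuple d :=
  LinearMap.pi fun j =>
    (-(μ : ℂ)) • ((laplacianCLM ℂ (RSpace d) 𝓢(RSpace d, ℂ)).toLinearMap ∘ₗ LinearMap.proj j)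
      - ((lam + μ : ℝ) : ℂ) • (partialD j ∘ₗ divergence)

theorem negLame_apply {d : ℕ} (lam μ : ℝ) (u : SchwartzTuple d) (j : Fin d) :
    negLame d lam μ u j = (-(μ : ℂ)) • Δ (u j) - ((lam + μ : ℝ) : ℂ) •
      ∂_{(EuclideanSpace.single j (1 : ℝ) : RSpace d)}
        (∑ k, ∂_{(EuclideanSpace.single k (1 : ℝ) : RSpace d)} (u k)) := by
  simp [negLame, partialD, divergence]

/-- The half-line `[0, ∞)`, as a subset of `ℂ`. -/
def halfLine : Set ℂ := (fun x : ℝ => (x : ℂ)) '' Set.Ici 0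

/-- `-Δ* - z` on `𝓢(ℝ^d)^d`. -/
def negLameSub (d : ℕ) (lam μ : ℝ) (z : ℂ) : SchwartzTuple d →ₗ[ℂ] SchwartzTuple d :=
  negLame d lam μ - z • LinearMap.id

theorem symbol_ne_zero {z : ℂ} (hz : z ∉ halfLine) {r : ℝ} (hr : 0 ≤ r) : (r : ℂ) - z ≠ 0 :=
  fun h => hz ⟨r, hr, sub_eq_zero.mp h⟩

theorem hasTemperateGrowth_symbol_inv {d : ℕ} {z : ℂ} (hz : z ∉ halfLine) {a : ℝ} (ha : 0 < a) :
    (fun x : RSpace d => (((a * ‖x‖ ^ 2 : ℝ) : ℂ) - z)⁻¹).HasTemperateGrowth := by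
  have hsq := Function.hasTemperateGrowth_norm_sq (H := RSpace d)
  by_cases him : z.im = 0
  · have hre : z.re < 0 := by
      by_contra h
      exact hz ⟨z.re, not_lt.mp h, by apply Complex.ext <;> simp [him]⟩
    have hb : 0 < a / (-z.re) := by apply div_pos ha; linarith
    have h1 : (fun x : RSpace d => (1 + ‖Real.sqrt (a / (-z.re)) • x‖ ^ 2) ^ (-1 : ℝ)
        ).HasTemperateGrowth := by
      have := (Function.hasTemperateGrowth_one_add_norm_sq_rpow (RSpace d) (-1)).comp
        ((Real.sqrt (a / (-z.re))) • ContinuousLinearMap.id ℝ (RSpace d)).hasTemperateGrowth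
      exact this
    have h2 := (Function.HasTemperateGrowth.const (E := RSpace d) ((-z.re : ℂ)⁻¹)).mul
      (Function.Complex.hasTemperateGrowth_ofReal.comp h1)
    refine Eq.subst (motive := fun g : RSpace d → ℂ => g.HasTemperateGrowth) ?_ h2
    funext x
    symm
    simp only [Pi.mul_apply, Function.comp_apply]
    have hzz : z = (z.re : ℂ) := by apply Complex.ext <;> simp [him]
    rw [norm_smul, mul_pow, Real.norm_eq_abs, sq_abs, Real.sq_sqrt hb.le, Real.rpow_neg_one]
    rw [Complex.ofReal_inv, ← mul_inv]
    congr 1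
    conv_lhs => rw [hzz]
    have : (z.re : ℂ) ≠ 0 := by exact_mod_cast hre.ne
    push_cast
    field_simp
    ring
  · have h0 : (fun x : RSpace d => (a * ‖x‖ ^ 2 - z.re) / z.im).HasTemperateGrowth := by
      have := (((Function.HasTemperateGrowth.const (E := RSpace d) a).mul hsq).sub
        (Function.HasTemperateGrowth.const (E := RSpace d) z.re)).mul
        (Function.HasTemperateGrowth.const (E := RSpace d) (z.im)⁻¹)
      exact this
    have h1 : (fun x : RSpace d => (1 + ‖(a * ‖x‖ ^ 2 - z.re) / z.im‖ ^ 2) ^ (-1 : ℝ)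
        ).HasTemperateGrowth :=
      (Function.hasTemperateGrowth_one_add_norm_sq_rpow ℝ (-1)).comp h0
    have h2 := ((Function.HasTemperateGrowth.const (E := RSpace d) (((z.im : ℂ) ^ 2)⁻¹)).mul
      (Function.Complex.hasTemperateGrowth_ofReal.comp h1)).mul
      ((Function.Complex.hasTemperateGrowth_ofReal.comp
        ((Function.HasTemperateGrowth.const (E := RSpace d) a).mul hsq)).sub
        (Function.HasTemperateGrowth.const (E := RSpace d) (starRingEnd ℂ z)))
    refine Eq.subst (motive := fun g : RSpace d → ℂ => g.HasTemperateGrowth) ?_ h2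
    funext x
    symm
    simp only [Pi.mul_apply, Pi.sub_apply, Function.comp_apply]
    have hne := symbol_ne_zero hz (show 0 ≤ a * ‖x‖ ^ 2 by positivity)
    generalize a * ‖x‖ ^ 2 = r at *
    rw [Real.norm_eq_abs, sq_abs, Real.rpow_neg_one, Complex.ofReal_inv, ← mul_inv]
    have key : ((z.im : ℂ) ^ 2 * ((1 + ((r - z.re) / z.im) ^ 2 : ℝ) : ℂ))
        = ((r : ℂ) - z) * ((r : ℂ) - starRingEnd ℂ z) := by
      have : (z.im : ℂ) ≠ 0 := by exact_mod_cast him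
      have e1 : ((z.im : ℂ) ^ 2 * ((1 + ((r - z.re) / z.im) ^ 2 : ℝ) : ℂ))
        = ((z.im ^ 2 + (r - z.re) ^ 2 : ℝ) : ℂ) := by
        push_cast
        field_simp
      rw [e1]
      apply Complex.ext
      · rw [Complex.ofReal_re]
        simp
        ring
      · rw [Complex.ofReal_im]
        simp
        ring
    have hne' : (r : ℂ) - starRingEnd ℂ z ≠ 0 := by
      intro h
      apply hne
      have := congrArg (starRingEnd ℂ) h
      simpa using this
    rw [key]
    field_simp

/-- On the Fourier side, `-Δ* - z` is multiplication by the matrix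
`(μ |ξ|² - z) I + (λ + μ) ξ ξᵗ`, up to the normalization `ξ ↦ 2 π ξ`. -/
theorem fourier_negLameSub {d : ℕ} (lam μ : ℝ) (z : ℂ) (u : SchwartzTuple d) (j : Fin d)
    (ξ : RSpace d) :
    𝓕 (negLameSub d lam μ z u j) ξ =
      (((μ * (2 * Real.pi) ^ 2 * ‖ξ‖ ^ 2 : ℝ) : ℂ) - z) * 𝓕 (u j) ξ
      + (((lam + μ) * (2 * Real.pi) ^ 2 : ℝ) : ℂ) * ξ j * ∑ k, ξ k * 𝓕 (u k) ξ := by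
  have hsq := Function.hasTemperateGrowth_norm_sq (H := RSpace d)
  have hin : ∀ m : RSpace d, (inner ℝ · m).HasTemperateGrowth := fun m =>
    Function.hasTemperateGrowth_inner_left m
  have hD : ∀ (k : Fin d) (f : 𝓢(RSpace d, ℂ)),
      𝓕 (∂_{(EuclideanSpace.single k (1 : ℝ) : RSpace d)} f) ξ
        = 2 * Real.pi * Complex.I * (ξ k * 𝓕 f ξ) := by
    intro k f
    rw [SchwartzMap.fourier_lineDerivOp_eq, _root_.smul_apply,
      SchwartzMap.smulLeftCLM_apply_apply (hin _)]
    simp [EuclideanSpace.inner_single_right]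
  have hL : ∀ f : 𝓢(RSpace d, ℂ), 𝓕 (Δ f) ξ = -(((2 * Real.pi) ^ 2 * ‖ξ‖ ^ 2 : ℝ) : ℂ) * 𝓕 f ξ := by
    intro f
    rw [SchwartzMap.laplacian_eq_fourierMultiplierCLM, fourierMultiplierCLM_apply,
      ← FourierTransform.fourierInv_smul, FourierTransform.fourier_fourierInv_eq]
    rw [_root_.smul_apply, SchwartzMap.smulLeftCLM_apply_apply hsq]
    simp
    ring
  have hadd : ∀ f g : 𝓢(RSpace d, ℂ), 𝓕 (f - g) = 𝓕 f - 𝓕 g :=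
    (fourierCLM ℂ 𝓢(RSpace d, ℂ)).map_sub
  have hsum : 𝓕 (∑ k, ∂_{(EuclideanSpace.single k (1 : ℝ) : RSpace d)} (u k))
      = ∑ k, 𝓕 (∂_{(EuclideanSpace.single k (1 : ℝ) : RSpace d)} (u k)) :=
    map_sum (fourierCLM ℂ 𝓢(RSpace d, ℂ)) _ _
  have h1 : negLameSub d lam μ z u j = negLame d lam μ u j - z • u j := by
    simp [negLameSub]
  rw [h1, negLame_apply, hadd, hadd, FourierTransform.fourier_smul, FourierTransform.fourier_smul,
    FourierTransform.fourier_smul]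
  simp only [_root_.sub_apply, _root_.smul_apply, smul_eq_mul, hD, hL, hsum, _root_.sum_apply]
  rw [← Finset.mul_sum]
  have hI := Complex.I_sq
  push_cast
  linear_combination (-(lam + μ) * 4 * Real.pi ^ 2 * ξ j * ∑ k, ξ k * 𝓕 (u k) ξ : ℂ) * hI

theorem sum_sq_eq_norm_sq {d : ℕ} (ξ : RSpace d) :
    ∑ k, (ξ k : ℂ) * (ξ k : ℂ) = ((‖ξ‖ ^ 2 : ℝ) : ℂ) := by
  rw [EuclideanSpace.norm_sq_eq]
  push_cast
  refine Finset.sum_congr rfl fun k _ => ?_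
  rw [← sq, ← Complex.ofReal_pow, ← Complex.ofReal_pow, Real.norm_eq_abs, sq_abs]

theorem fourier_schwartz_injective {d : ℕ} :
    Function.Injective (fun g : 𝓢(RSpace d, ℂ) => (𝓕 g : 𝓢(RSpace d, ℂ))) := fun a b hab => by
  have h : (𝓕⁻ (𝓕 a : 𝓢(RSpace d, ℂ)) : 𝓢(RSpace d, ℂ)) = 𝓕⁻ (𝓕 b : 𝓢(RSpace d, ℂ)) :=
    congrArg _ hab
  rwa [FourierTransform.fourierInv_fourier_eq, FourierTransform.fourierInv_fourier_eq] at h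

/-- For `μ > 0`, `λ + 2 μ > 0` and `z ∉ [0, ∞)` the operator `-Δ* - z` is a bijection of
`𝓢(ℝ^d)^d`. -/
theorem negLameSub_bijective {d : ℕ} {lam μ : ℝ} {z : ℂ} (hμ : 0 < μ) (hlam : 0 < lam + 2 * μ)
    (hz : z ∉ halfLine) : Function.Bijective (negLameSub d lam μ z) := by
  have hA : ∀ ξ : RSpace d, (((μ * (2 * Real.pi) ^ 2 * ‖ξ‖ ^ 2 : ℝ) : ℂ) - z) ≠ 0 := fun ξ =>
    symbol_ne_zero hz (by positivity)
  have hB : ∀ ξ : RSpace d, ((((lam + 2 * μ) * (2 * Real.pi) ^ 2 * ‖ξ‖ ^ 2 : ℝ) : ℂ) - z) ≠ 0 :=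
    fun ξ => symbol_ne_zero hz (by positivity)
  constructor
  · rw [injective_iff_map_eq_zero]
    intro u hu
    have key : ∀ (j : Fin d) (ξ : RSpace d),
        (((μ * (2 * Real.pi) ^ 2 * ‖ξ‖ ^ 2 : ℝ) : ℂ) - z) * 𝓕 (u j) ξ
        + (((lam + μ) * (2 * Real.pi) ^ 2 : ℝ) : ℂ) * ξ j * ∑ k, ξ k * 𝓕 (u k) ξ = 0 := by
      intro j ξ
      rw [← fourier_negLameSub, hu]
      have : 𝓕 (0 : 𝓢(RSpace d, ℂ)) = 0 := (fourierCLM ℂ 𝓢(RSpace d, ℂ)).map_zero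
      simp [this]
    have hdiv : ∀ ξ : RSpace d, ∑ k, ξ k * 𝓕 (u k) ξ = 0 := by
      intro ξ
      apply (mul_eq_zero.mp _).resolve_left (hB ξ)
      have h := Finset.sum_congr rfl fun (j : Fin d) (_ : j ∈ Finset.univ) =>
        congrArg (fun w => (ξ j : ℂ) * w) (key j ξ)
      simp only [mul_add, Finset.sum_add_distrib, mul_zero, Finset.sum_const_zero] at h
      have e1 : ∑ j, (ξ j : ℂ) * ((((μ * (2 * Real.pi) ^ 2 * ‖ξ‖ ^ 2 : ℝ) : ℂ) - z) * 𝓕 (u j) ξ)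
          = (((μ * (2 * Real.pi) ^ 2 * ‖ξ‖ ^ 2 : ℝ) : ℂ) - z) * ∑ k, ξ k * 𝓕 (u k) ξ := by
        rw [Finset.mul_sum]
        exact Finset.sum_congr rfl fun k _ => by ring
      have e2 : ∑ j, (ξ j : ℂ) * ((((lam + μ) * (2 * Real.pi) ^ 2 : ℝ) : ℂ) * ξ j *
            ∑ k, ξ k * 𝓕 (u k) ξ)
          = (((lam + μ) * (2 * Real.pi) ^ 2 : ℝ) : ℂ) * ((‖ξ‖ ^ 2 : ℝ) : ℂ) *
            ∑ k, ξ k * 𝓕 (u k) ξ := by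
        rw [← sum_sq_eq_norm_sq]
        generalize ∑ k, (ξ k : ℂ) * 𝓕 (u k) ξ = G
        rw [Finset.mul_sum, Finset.sum_mul]
        exact Finset.sum_congr rfl fun k _ => by ring
      rw [e1, e2] at h
      rw [← h]
      push_cast
      ring
    funext j
    have hF : 𝓕 (u j) = 0 := by
      ext ξ
      have := key j ξ
      rw [hdiv ξ, mul_zero, add_zero] at this
      simpa using (mul_eq_zero.mp this).resolve_left (hA ξ)
    exact fourier_schwartz_injective (hF.trans (fourierCLM ℂ 𝓢(RSpace d, ℂ)).map_zero.symm)
  · intro f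
    have gA := hasTemperateGrowth_symbol_inv (d := d) hz
      (show 0 < μ * (2 * Real.pi) ^ 2 by positivity)
    have gB := hasTemperateGrowth_symbol_inv (d := d) hz
      (show 0 < (lam + 2 * μ) * (2 * Real.pi) ^ 2 by positivity)
    have hX : ∀ k : Fin d, (fun ξ : RSpace d => (ξ k : ℂ)).HasTemperateGrowth := by
      intro k
      have := Function.Complex.hasTemperateGrowth_ofReal.comp
        (Function.hasTemperateGrowth_inner_left (EuclideanSpace.single k (1 : ℝ) : RSpace d))
      refine Eq.subst (motive := fun g : RSpace d → ℂ => g.HasTemperateGrowth) ?_ this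
      funext ξ
      simp [EuclideanSpace.inner_single_right]
    let m : Fin d → Fin d → RSpace d → ℂ := fun j k =>
      (fun ξ : RSpace d => (((μ * (2 * Real.pi) ^ 2 * ‖ξ‖ ^ 2 : ℝ) : ℂ) - z)⁻¹) *
      ((fun _ => ((if j = k then 1 else 0 : ℂ))) -
        (fun _ => (((lam + μ) * (2 * Real.pi) ^ 2 : ℝ) : ℂ)) *
        (fun ξ : RSpace d => ((((lam + 2 * μ) * (2 * Real.pi) ^ 2 * ‖ξ‖ ^ 2 : ℝ) : ℂ) - z)⁻¹) *
        (fun ξ : RSpace d => (ξ j : ℂ)) * (fun ξ : RSpace d => (ξ k : ℂ)))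
    have hm : ∀ j k, (m j k).HasTemperateGrowth := fun j k =>
      gA.mul ((Function.HasTemperateGrowth.const _).sub
        ((((Function.HasTemperateGrowth.const _).mul gB).mul (hX j)).mul (hX k)))
    refine ⟨fun j => 𝓕⁻ (∑ k, smulLeftCLM ℂ (m j k) (𝓕 (f k))), ?_⟩
    funext j
    apply fourier_schwartz_injective
    ext ξ
    simp only [fourier_negLameSub, FourierTransform.fourier_fourierInv_eq, _root_.sum_apply,
      SchwartzMap.smulLeftCLM_apply_apply (hm _ _), smul_eq_mul]
    have hv : ∀ j : Fin d, ∑ k, m j k ξ * 𝓕 (f k) ξ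
        = (((μ * (2 * Real.pi) ^ 2 * ‖ξ‖ ^ 2 : ℝ) : ℂ) - z)⁻¹ * (𝓕 (f j) ξ -
          (((lam + μ) * (2 * Real.pi) ^ 2 : ℝ) : ℂ) *
          ((((lam + 2 * μ) * (2 * Real.pi) ^ 2 * ‖ξ‖ ^ 2 : ℝ) : ℂ) - z)⁻¹ * ξ j *
          ∑ k, ξ k * 𝓕 (f k) ξ) := by
      intro j
      simp only [m, Pi.mul_apply, Pi.sub_apply, mul_assoc, sub_mul, ← Finset.mul_sum,
        Finset.sum_sub_distrib]
      simp
    simp only [hv]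
    have hG : ∑ l, (ξ l : ℂ) * ((((μ * (2 * Real.pi) ^ 2 * ‖ξ‖ ^ 2 : ℝ) : ℂ) - z)⁻¹ *
          (𝓕 (f l) ξ - (((lam + μ) * (2 * Real.pi) ^ 2 : ℝ) : ℂ) *
          ((((lam + 2 * μ) * (2 * Real.pi) ^ 2 * ‖ξ‖ ^ 2 : ℝ) : ℂ) - z)⁻¹ * ξ l *
          ∑ k, ξ k * 𝓕 (f k) ξ))
        = ((((lam + 2 * μ) * (2 * Real.pi) ^ 2 * ‖ξ‖ ^ 2 : ℝ) : ℂ) - z)⁻¹ *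
          ∑ k, ξ k * 𝓕 (f k) ξ := by
      have hBA : (((μ * (2 * Real.pi) ^ 2 * ‖ξ‖ ^ 2 : ℝ) : ℂ) - z)
          = ((((lam + 2 * μ) * (2 * Real.pi) ^ 2 * ‖ξ‖ ^ 2 : ℝ) : ℂ) - z) -
            (((lam + μ) * (2 * Real.pi) ^ 2 : ℝ) : ℂ) * ((‖ξ‖ ^ 2 : ℝ) : ℂ) := by
        push_cast
        ring
      have hAA := hA ξ
      have hBB := hB ξ
      generalize ((((lam + 2 * μ) * (2 * Real.pi) ^ 2 * ‖ξ‖ ^ 2 : ℝ) : ℂ) - z) = B at *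
      generalize (((μ * (2 * Real.pi) ^ 2 * ‖ξ‖ ^ 2 : ℝ) : ℂ) - z) = A at *
      generalize (((lam + μ) * (2 * Real.pi) ^ 2 : ℝ) : ℂ) = c at *
      rw [← sum_sq_eq_norm_sq] at hBA
      generalize hGdef : ∑ k, (ξ k : ℂ) * 𝓕 (f k) ξ = G
      have : ∑ l, (ξ l : ℂ) * (A⁻¹ * (𝓕 (f l) ξ - c * B⁻¹ * ξ l * G))
          = A⁻¹ * (G - c * B⁻¹ * (∑ l, (ξ l : ℂ) * ξ l) * G) := by
        have hs : G - c * B⁻¹ * (∑ l, (ξ l : ℂ) * ξ l) * G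
            = ∑ l, ((ξ l : ℂ) * 𝓕 (f l) ξ - c * B⁻¹ * (ξ l * ξ l) * G) := by
          rw [Finset.sum_sub_distrib, hGdef, Finset.mul_sum, Finset.sum_mul]
        rw [hs, Finset.mul_sum]
        exact Finset.sum_congr rfl fun k _ => by ring
      rw [this]
      field_simp
      rw [hBA]
      ring_nf
    rw [hG, mul_inv_cancel_left₀ (hA ξ)]
    ring

/-- The resolvent `(-Δ* - z)⁻¹` on `𝓢(ℝ^d)^d`: the inverse of the bijection `-Δ* - z`. -/
def lameResolvent (d : ℕ) {lam μ : ℝ} {z : ℂ} (hμ : 0 < μ) (hlam : 0 < lam + 2 * μ)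
    (hz : z ∉ halfLine) : SchwartzTuple d →ₗ[ℂ] SchwartzTuple d :=
  (LinearEquiv.ofBijective (negLameSub d lam μ z) (negLameSub_bijective hμ hlam hz)).symm

/-- `‖u‖_{L^q(ℝ^d)^d}`: `(∑ j, ‖u_j‖_q ^ q) ^ (1 / q)` if `q < ∞`, and `max_j ‖u_j‖_∞` if
`q = ∞`. -/
def tupleLpNorm {d : ℕ} (q : ℝ≥0∞) (u : SchwartzTuple d) : ℝ≥0∞ :=
  if q = ∞ then ⨆ j, eLpNorm (u j) ∞ volume
  else (∑ j, eLpNorm (u j) q volume ^ q.toReal) ^ (1 / q.toReal)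

/-- `‖T‖_{p → q}`: the infimum of the constants `0 ≤ K < ∞` with `‖T f‖_q ≤ K ‖f‖_p` for all
`f ∈ 𝓢(ℝ^d)^d`, which is `∞` if there is no such `K`. -/
def opNormLpLq {d : ℕ} (p q : ℝ≥0∞) (T : SchwartzTuple d →ₗ[ℂ] SchwartzTuple d) : ℝ≥0∞ :=
  ⨅ (K : ℝ≥0) (_ : ∀ f, tupleLpNorm q (T f) ≤ (K : ℝ≥0∞) * tupleLpNorm p f), (K : ℝ≥0∞)

/-- The admissible set `R_0` of points `(1/p, 1/q)` in the unit square. -/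
def admissibleSet (d : ℕ) : Set (ℝ × ℝ) :=
  if d = 2 then
    {P | P ∈ Set.Icc (0 : ℝ) 1 ×ˢ Set.Icc (0 : ℝ) 1 ∧ 0 ≤ P.1 - P.2 ∧ P.1 - P.2 < 1}
  else
    {P | P ∈ Set.Icc (0 : ℝ) 1 ×ˢ Set.Icc (0 : ℝ) 1 ∧ 0 ≤ P.1 - P.2 ∧ P.1 - P.2 ≤ 2 / (d : ℝ)} \
      {((1 : ℝ), ((d : ℝ) - 2) / d), (2 / (d : ℝ), (0 : ℝ))}

end

/-! A finite norm of the resolvent is an a priori estimate `‖u_i‖_q ≤ K ∑ ‖((-Δ* - z) u)_j‖_p`,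
which can be refuted on explicit `u`. Write `x = 1/p`, `y = 1/q`.

Dilating a fixed bump tuple by `s` multiplies `-Δ* u` by `s²` and leaves `z u` unscaled, so `s^{d(x
- y)} a ≤ s² A + B` for all `s > 0` with some `a > 0`. Letting `s → 0` gives `x ≥ y`, and `s → ∞`
gives `x - y ≤ 2/d` (`AprioriBound.scaling_range`). What remains are endpoints, each reduced to
refuting a bound of `|u_i(0)|` by an `L^r` norm of `(-Δ* - z) u` (`EvalBound`).

For `d ≥ 3` the corner `(2/d, 0)` is the case `r = d/2`, and the corner `(1, (d-2)/d)` is dual to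
it, since `-Δ* - z` is symmetric for the bilinear pairing. A sum of `N` dilates of a bump by powers
of `4` takes the value `N` at `0`. Its image under `-Δ*` consists of `N` disjointly supported pieces
of equal `L^{d/2}` norm, of total norm `N^{2/d}` times a constant, while the `z` term stays bounded.
This is impossible as `2/d < 1` (`not_evalBound_half_dim`).

For `d = 2` only `(1, 0)` remains, where the exponent `2/d = 1` makes that comparison useless.
Instead the resolvent is applied to an `L¹`-bounded approximate identity: the trace of its values at
`0` is a cut-off integral of a symbol of size `|ξ|⁻²`, which diverges logarithmically in the plane
(`not_evalBound_two`). -/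

noncomputable section

/-! ### From the operator norm to an a priori estimate -/

section TupleNorm

variable {d : ℕ} {p q : ℝ≥0∞}

theorem eLpNorm_le_tupleLpNorm (hq : 1 ≤ q) (u : SchwartzTuple d) (i : Fin d) :
    eLpNorm (u i) q volume ≤ tupleLpNorm q u := by
  unfold tupleLpNorm
  split_ifs with h
  · subst h
    exact le_iSup (fun j => eLpNorm (u j) ∞ volume) i
  · have hq0 : 0 < q.toReal := ENNReal.toReal_pos (by positivity) h
    rw [one_div, ENNReal.le_rpow_inv_iff hq0]
    exact Finset.single_le_sum (f := fun j => eLpNorm (u j) q volume ^ q.toReal)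
      (fun _ _ => zero_le) (Finset.mem_univ i)

theorem ENNReal.sum_rpow_inv_le {ι : Type*} (s : Finset ι) (a : ι → ℝ≥0∞) {r : ℝ} (hr : 1 ≤ r) :
    (∑ j ∈ s, a j ^ r) ^ (1 / r) ≤ ∑ j ∈ s, a j := by
  classical
  have hr0 : 0 < r := by linarith
  induction s using Finset.induction_on with
  | empty => simp [hr0]
  | insert i s hi ih =>
    rw [Finset.sum_insert hi, Finset.sum_insert hi]
    have := ENNReal.rpow_add_rpow_le_add (a i) ((∑ j ∈ s, a j ^ r) ^ (1 / r)) hr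
    rw [← ENNReal.rpow_mul, one_div_mul_cancel hr0.ne', ENNReal.rpow_one] at this
    exact this.trans (by gcongr)

theorem tupleLpNorm_le_sum (hp : 1 ≤ p) (f : SchwartzTuple d) :
    tupleLpNorm p f ≤ ∑ j, eLpNorm (f j) p volume := by
  unfold tupleLpNorm
  split_ifs with h
  · subst h
    exact iSup_le fun j => Finset.single_le_sum (f := fun j => eLpNorm (f j) ∞ volume)
      (fun _ _ => zero_le) (Finset.mem_univ j)
  · exact ENNReal.sum_rpow_inv_le _ _ (by simpa using ENNReal.toReal_mono h hp)

/-- The a priori estimate `‖u_i‖_q ≤ K ∑ j, ‖((-Δ* - z) u)_j‖_p` for all Schwartz tuples `u`. -/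
def AprioriBound (d : ℕ) (lam μ : ℝ) (z : ℂ) (p q : ℝ≥0∞) (K : ℝ≥0) : Prop :=
  ∀ (u : SchwartzTuple d) (i : Fin d), eLpNorm (u i) q volume ≤
    (K : ℝ≥0∞) * ∑ j, eLpNorm (negLameSub d lam μ z u j) p volume

/-- Substituting `f = (-Δ* - z) u` removes the inverse, so later test functions `u` can be chosen
freely. A finite infimum provides an actual constant because the infimum over no constants is `∞`.
-/
theorem exists_aprioriBound {lam μ : ℝ} {z : ℂ} (hμ : 0 < μ) (hlam : 0 < lam + 2 * μ)
    (hz : z ∉ halfLine) (hp : 1 ≤ p) (hq : 1 ≤ q)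
    (h : opNormLpLq p q (lameResolvent d hμ hlam hz) ≠ ∞) :
    ∃ K : ℝ≥0, AprioriBound d lam μ z p q K := by
  have h' : ∃ K : ℝ≥0, ∀ f, tupleLpNorm q (lameResolvent d hμ hlam hz f) ≤
      (K : ℝ≥0∞) * tupleLpNorm p f := by
    by_contra hc
    push Not at hc
    apply h
    simp only [opNormLpLq, iInf_eq_top]
    intro K hK
    obtain ⟨f, hf⟩ := hc K
    exact absurd (hK f) hf.not_ge
  obtain ⟨K, hK⟩ := h'
  refine ⟨K, fun u i => ?_⟩
  have hu : lameResolvent d hμ hlam hz (negLameSub d lam μ z u) = u :=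
    (LinearEquiv.ofBijective _ (negLameSub_bijective hμ hlam hz)).symm_apply_apply u
  have := hK (negLameSub d lam μ z u)
  rw [hu] at this
  exact (eLpNorm_le_tupleLpNorm hq u i).trans (this.trans (by gcongr; exact tupleLpNorm_le_sum hp _))

end TupleNorm

/-! ### Behaviour of `-Δ*` and of the `L^p` norms under dilations -/

section Dilation

variable {d : ℕ}

/-- The dilation `x ↦ φ (s x)` of a Schwartz function. -/
def dilation (s : ℝ) (hs : s ≠ 0) : 𝓢(RSpace d, ℂ) →ₗ[ℂ] 𝓢(RSpace d, ℂ) :=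
  (compCLMOfContinuousLinearEquiv ℂ
    (ContinuousLinearEquiv.smulLeft (Units.mk0 s hs) : RSpace d ≃L[ℝ] RSpace d)).toLinearMap

@[simp]
theorem dilation_apply (s : ℝ) (hs : s ≠ 0) (φ : 𝓢(RSpace d, ℂ)) (x : RSpace d) :
    dilation s hs φ x = φ (s • x) := rfl

theorem lineDerivOp_dilation (s : ℝ) (hs : s ≠ 0) (m : RSpace d) (φ : 𝓢(RSpace d, ℂ)) :
    ∂_{m} (dilation s hs φ) = (s : ℂ) • dilation s hs (∂_{m} φ) := by
  ext x
  have h1 : HasFDerivAt (fun x : RSpace d => φ (s • x))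
      ((fderiv ℝ φ (s • x)).comp (s • ContinuousLinearMap.id ℝ (RSpace d))) x :=
    (φ.hasFDerivAt (s • x)).comp x ((hasFDerivAt_id x).const_smul s)
  have h2 : ∂_{m} (dilation s hs φ) x = fderiv ℝ (fun x : RSpace d => φ (s • x)) x m := rfl
  rw [h2, h1.fderiv]
  simp [lineDerivOp_apply_eq_fderiv]

theorem laplacian_dilation (s : ℝ) (hs : s ≠ 0) (φ : 𝓢(RSpace d, ℂ)) :
    Δ (dilation s hs φ) = ((s ^ 2 : ℝ) : ℂ) • dilation s hs (Δ φ) := by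
  simp only [SchwartzMap.laplacian_eq_sum (EuclideanSpace.basisFun (Fin d) ℝ),
    lineDerivOp_dilation, lineDerivOp_smul, map_sum, Finset.smul_sum, smul_smul]
  push_cast
  simp only [sq]

theorem negLame_dilation (lam μ : ℝ) (s : ℝ) (hs : s ≠ 0) (u : SchwartzTuple d) (j : Fin d) :
    negLame d lam μ (fun k => dilation s hs (u k)) j
      = ((s ^ 2 : ℝ) : ℂ) • dilation s hs (negLame d lam μ u j) := by
  simp only [negLame_apply, laplacian_dilation, lineDerivOp_dilation, ← Finset.smul_sum,
    lineDerivOp_smul, ← map_sum, map_sub, map_smul]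
  rw [smul_sub, smul_comm, smul_smul (s : ℂ) (s : ℂ)]
  rw [smul_comm ((s ^ 2 : ℝ) : ℂ) (((lam + μ : ℝ)) : ℂ)]
  push_cast
  rw [sq]

/-- Change of variables in Lebesgue measure. With `p⁻¹.toReal` in the exponent the case `p = ∞` is
included, the factor being `1`. -/
theorem eLpNorm_dilation (s : ℝ) (hs : 0 < s) (φ : 𝓢(RSpace d, ℂ)) (p : ℝ≥0∞) :
    eLpNorm (dilation s hs.ne' φ) p volume
      = ENNReal.ofReal (s ^ (-((d : ℝ) * p⁻¹.toReal))) * eLpNorm φ p volume := by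
  have h1 : eLpNorm (dilation s hs.ne' φ) p volume
      = eLpNorm φ p (Measure.map (fun x : RSpace d => s • x) volume) := by
    rw [eLpNorm_map_measure φ.continuous.aestronglyMeasurable (by fun_prop)]
    rfl
  have h2 : Measure.map (fun x : RSpace d => s • x) volume
      = ENNReal.ofReal |(s ^ d)⁻¹| • (volume : Measure (RSpace d)) := by
    simpa using Measure.map_addHaar_smul (volume : Measure (RSpace d)) hs.ne'
  have h3 : 0 < (s ^ d)⁻¹ := by positivity
  rw [h1, h2, eLpNorm_smul_measure_of_ne_zero (by simp; positivity), smul_eq_mul,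
    abs_of_pos h3, ENNReal.ofReal_rpow_of_pos h3]
  congr 2
  rw [← Real.rpow_natCast, ← Real.rpow_neg hs.le, ← Real.rpow_mul hs.le]
  simp

end Dilation

/-! ### Scaling restrictions on the exponents -/

section Scaling

variable {d : ℕ} {p q : ℝ≥0∞} {lam μ : ℝ} {z : ℂ} {K : ℝ≥0}

theorem negLameSub_eq_sub (lam μ : ℝ) (z : ℂ) (u : SchwartzTuple d) (j : Fin d) :
    negLameSub d lam μ z u j = negLame d lam μ u j - z • u j := by
  simp [negLameSub]

theorem eLpNorm_negLameSub_le (hp : 1 ≤ p) (u : SchwartzTuple d) (j : Fin d) :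
    eLpNorm (negLameSub d lam μ z u j) p volume
      ≤ eLpNorm (negLame d lam μ u j) p volume + ‖z‖ₑ * eLpNorm (u j) p volume := by
  rw [negLameSub_eq_sub, ← eLpNorm_const_smul]
  exact eLpNorm_sub_le (SchwartzMap.continuous _).aestronglyMeasurable
    (z • u j).continuous.aestronglyMeasurable hp

theorem eLpNorm_smul_schwartz (c : ℂ) (φ : 𝓢(RSpace d, ℂ)) (p : ℝ≥0∞) :
    eLpNorm (c • φ) p volume = ‖c‖ₑ * eLpNorm φ p volume :=
  eLpNorm_const_smul c φ p volume

theorem eLpNorm_schwartz_ne_top (φ : 𝓢(RSpace d, ℂ)) (p : ℝ≥0∞) : eLpNorm φ p volume ≠ ∞ :=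
  (φ.eLpNorm_lt_top p volume).ne

theorem enorm_complex_ofReal {t : ℝ} (ht : 0 ≤ t) : ‖(t : ℂ)‖ₑ = ENNReal.ofReal t := by
  rw [← ofReal_norm, Complex.norm_real, Real.norm_of_nonneg ht]

theorem eLpNorm_negLameSub_dilation_le (hp : 1 ≤ p) (u : SchwartzTuple d) (j : Fin d) {s : ℝ}
    (hs : 0 < s) :
    eLpNorm (negLameSub d lam μ z (fun k => dilation s hs.ne' (u k)) j) p volume ≤
      ENNReal.ofReal (s ^ (-((d : ℝ) * p⁻¹.toReal)) *
        (s ^ 2 * (eLpNorm (negLame d lam μ u j) p volume).toReal +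
          ‖z‖ * (eLpNorm (u j) p volume).toReal)) := by
  refine (eLpNorm_negLameSub_le hp _ j).trans_eq ?_
  rw [negLame_dilation, eLpNorm_smul_schwartz, eLpNorm_dilation s hs, eLpNorm_dilation s hs,
    enorm_complex_ofReal (by positivity), mul_add,
    ENNReal.ofReal_add (by positivity) (by positivity)]
  generalize hN : eLpNorm (negLame d lam μ u j) p volume = N
  generalize hM : eLpNorm (u j) p volume = M
  have hN' : N ≠ ∞ := hN ▸ eLpNorm_schwartz_ne_top _ p
  have hM' : M ≠ ∞ := hM ▸ eLpNorm_schwartz_ne_top _ p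
  rw [ENNReal.ofReal_mul (by positivity), ENNReal.ofReal_mul (by positivity),
    ENNReal.ofReal_mul (by positivity), ENNReal.ofReal_mul (by positivity),
    ENNReal.ofReal_toReal hN', ENNReal.ofReal_toReal hM', ofReal_norm]
  ring

theorem AprioriBound.scaling (h : AprioriBound d lam μ z p q K) (hp : 1 ≤ p)
    (u : SchwartzTuple d) (i : Fin d) :
    ∃ A B : ℝ, ∀ s : ℝ, 0 < s →
      s ^ (-((d : ℝ) * q⁻¹.toReal)) * (eLpNorm (u i) q volume).toReal
        ≤ s ^ (-((d : ℝ) * p⁻¹.toReal)) * (s ^ 2 * A + B) := by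
  refine ⟨K * ∑ j, (eLpNorm (negLame d lam μ u j) p volume).toReal,
    K * ∑ j, ‖z‖ * (eLpNorm (u j) p volume).toReal, fun s hs => ?_⟩
  have h1 := h (fun k => dilation s hs.ne' (u k)) i
  rw [eLpNorm_dilation s hs] at h1
  have h3 := h1.trans (mul_le_mul_right (Finset.sum_le_sum fun j _ =>
    eLpNorm_negLameSub_dilation_le hp u j hs) (K : ℝ≥0∞))
  rw [← ENNReal.ofReal_sum_of_nonneg (fun _ _ => by positivity), ← ENNReal.ofReal_coe_nnreal,
    ← ENNReal.ofReal_mul (by positivity),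
    ← ENNReal.ofReal_toReal (eLpNorm_schwartz_ne_top (u i) q),
    ← ENNReal.ofReal_mul (by positivity)] at h3
  refine ((ENNReal.ofReal_le_ofReal_iff (mul_nonneg K.2
    (Finset.sum_nonneg fun _ _ => by positivity))).1 h3).trans_eq ?_
  change (K : ℝ) * _ = _
  rw [← Finset.mul_sum, Finset.sum_add_distrib, ← Finset.mul_sum]
  generalize ∑ j, (eLpNorm (negLame d lam μ u j) p volume).toReal = N
  generalize ∑ j, ‖z‖ * (eLpNorm (u j) p volume).toReal = M
  ring

/-- The Schwartz function given by a smooth bump. -/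
def bumpSchwartz (f : ContDiffBump (0 : RSpace d)) : 𝓢(RSpace d, ℂ) :=
  HasCompactSupport.toSchwartzMap (f := fun x => (f x : ℂ))
    (f.hasCompactSupport.comp_left (g := fun t : ℝ => (t : ℂ)) Complex.ofReal_zero)
    (Complex.ofRealCLM.contDiff.comp f.contDiff)

@[simp]
theorem bumpSchwartz_apply (f : ContDiffBump (0 : RSpace d)) (x : RSpace d) :
    bumpSchwartz f x = f x := rfl

/-- A smooth bump equal to `1` on the unit ball and supported in the ball of radius `2`. -/
def unitBump (d : ℕ) : ContDiffBump (0 : RSpace d) := ⟨1, 2, by norm_num, by norm_num⟩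

theorem eLpNorm_schwartz_toReal_pos (hq : 1 ≤ q) (φ : 𝓢(RSpace d, ℂ)) (h : φ ≠ 0) :
    0 < (eLpNorm φ q volume).toReal := by
  refine ENNReal.toReal_pos (fun h0 => h ?_) (eLpNorm_schwartz_ne_top φ q)
  rw [eLpNorm_eq_zero_iff φ.continuous.aestronglyMeasurable (by positivity)] at h0
  have := (Continuous.ae_eq_iff_eq volume φ.continuous continuous_zero).1 h0
  ext x
  exact congrFun this x

theorem bumpSchwartz_unitBump_ne_zero : bumpSchwartz (unitBump d) ≠ 0 := by
  intro h
  have h1 : bumpSchwartz (unitBump d) 0 = 1 := by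
    rw [bumpSchwartz_apply, (unitBump d).one_of_mem_closedBall (by simp [unitBump])]
    simp
  rw [h] at h1
  simp at h1

/-- The left side of `key` is a power of `s` times `a > 0`. A negative exponent would make it blow
up at `s → 0`, where the right side tends to `B`; an exponent above `2` would outgrow `s² A + B` at
infinity. -/
theorem AprioriBound.scaling_range (h : AprioriBound d lam μ z p q K) (hd : 0 < d) (hp : 1 ≤ p)
    (hq : 1 ≤ q) : 0 ≤ p⁻¹.toReal - q⁻¹.toReal ∧ p⁻¹.toReal - q⁻¹.toReal ≤ 2 / (d : ℝ) := by
  let u : SchwartzTuple d := fun _ => bumpSchwartz (unitBump d)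
  obtain ⟨A, B, hAB⟩ := h.scaling hp u ⟨0, hd⟩
  have ha := eLpNorm_schwartz_toReal_pos hq (u ⟨0, hd⟩) bumpSchwartz_unitBump_ne_zero
  set a := (eLpNorm (u ⟨0, hd⟩) q volume).toReal
  set x := p⁻¹.toReal
  set y := q⁻¹.toReal
  have hd' : (0 : ℝ) < d := by exact_mod_cast hd
  have key : ∀ s : ℝ, 0 < s → s ^ ((d : ℝ) * (x - y)) * a ≤ s ^ 2 * A + B := by
    intro s hs
    have h1 := mul_le_mul_of_nonneg_left (hAB s hs) (Real.rpow_nonneg hs.le ((d : ℝ) * x))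
    rw [← mul_assoc, ← mul_assoc, ← Real.rpow_add hs, ← Real.rpow_add hs] at h1
    rw [add_neg_cancel, Real.rpow_zero, one_mul] at h1
    rwa [mul_sub, sub_eq_add_neg]
  constructor
  · by_contra hc
    push Not at hc
    have he : 0 < -((d : ℝ) * (x - y)) := by nlinarith
    have ht := ((tendsto_rpow_atTop he).atTop_mul_const ha).comp tendsto_inv_nhdsGT_zero
    have ht2 : Filter.Tendsto (fun s : ℝ => s ^ 2 * A + B) (nhdsWithin 0 (Set.Ioi 0)) (nhds B) := by
      have : Filter.Tendsto (fun s : ℝ => s ^ 2 * A + B) (nhds 0) (nhds (0 ^ 2 * A + B)) :=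
        (by fun_prop : Continuous fun s : ℝ => s ^ 2 * A + B).tendsto 0
      simpa using this.mono_left nhdsWithin_le_nhds
    refine not_tendsto_atTop_of_tendsto_nhds ht2 (Filter.tendsto_atTop_mono' _ ?_ ht)
    filter_upwards [self_mem_nhdsWithin] with s hs
    have hs : 0 < s := hs
    have := key s hs
    simpa [Real.inv_rpow hs.le, Real.rpow_neg hs.le] using this
  · by_contra hc
    push Not at hc
    have he : 0 < (d : ℝ) * (x - y) - 2 := by
      rw [div_lt_iff₀ hd'] at hc
      linarith
    have ht := (tendsto_rpow_atTop he).atTop_mul_const ha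
    have ht2 : Filter.Tendsto (fun s : ℝ => A + B * (s ^ 2)⁻¹) Filter.atTop (nhds (A + B * 0)) :=
      tendsto_const_nhds.add
        ((tendsto_inv_atTop_zero.comp (Filter.tendsto_pow_atTop (two_ne_zero))).const_mul B)
    refine not_tendsto_atTop_of_tendsto_nhds ht2 (Filter.tendsto_atTop_mono' _ ?_ ht)
    filter_upwards [Filter.eventually_gt_atTop 0] with s hs
    have := key s hs
    rw [Real.rpow_sub hs, Real.rpow_two, div_mul_eq_mul_div, div_le_iff₀ (by positivity)]
    refine this.trans_eq ?_
    field_simp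

end Scaling

/-! ### Evaluation at the origin and duality -/

section Evaluation

variable {d : ℕ} {p q : ℝ≥0∞} {lam μ : ℝ} {z : ℂ} {K : ℝ≥0}

/-- The a priori estimate `|u_i(0)| ≤ K ∑ j, ‖((-Δ* - z) u)_j‖_p` for all Schwartz tuples `u`. -/
def EvalBound (d : ℕ) (lam μ : ℝ) (z : ℂ) (p : ℝ≥0∞) (K : ℝ≥0) : Prop :=
  ∀ (u : SchwartzTuple d) (i : Fin d), ‖u i 0‖ₑ ≤
    (K : ℝ≥0∞) * ∑ j, eLpNorm (negLameSub d lam μ z u j) p volume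

/-- The essential bound holds on a set of full measure, hence dense, and this set is closed by
continuity. -/
theorem enorm_le_eLpNorm_top (φ : 𝓢(RSpace d, ℂ)) (x : RSpace d) :
    ‖φ x‖ₑ ≤ eLpNorm φ ∞ volume := by
  have h : ∀ᵐ y, ‖φ y‖ₑ ≤ eLpNorm φ ∞ volume := by
    rw [eLpNorm_exponent_top]
    exact ae_le_eLpNormEssSup
  have hc : IsClosed {y | ‖φ y‖ₑ ≤ eLpNorm φ ∞ volume} :=
    isClosed_le φ.continuous.enorm continuous_const
  have := hc.closure_eq ▸ (Measure.dense_of_ae h).closure_eq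
  exact Set.eq_univ_iff_forall.1 this x

theorem AprioriBound.evalBound (h : AprioriBound d lam μ z p ∞ K) : EvalBound d lam μ z p K :=
  fun u i => (enorm_le_eLpNorm_top (u i) 0).trans (h u i)

theorem integrable_mul_schwartz (f g : 𝓢(RSpace d, ℂ)) :
    Integrable (fun x => f x * g x) volume :=
  (SchwartzMap.pairing (ContinuousLinearMap.mul ℝ ℂ) f g).integrable

/-- Integration by parts. The pairing is bilinear, without conjugation, so `z` is not replaced by
its conjugate; the gradient-divergence term becomes the pairing of the two divergences. -/
theorem negLameSub_symm (u v : SchwartzTuple d) :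
    ∑ j, ∫ x, negLameSub d lam μ z v j x * u j x
      = ∑ j, ∫ x, v j x * negLameSub d lam μ z u j x := by
  let b : 𝓢(RSpace d, ℂ) → 𝓢(RSpace d, ℂ) → ℂ := fun f g => ∫ x, f x * g x
  have hcomm : ∀ f g, b f g = b g f := fun f g => by simp only [b, mul_comm]
  have hsub : ∀ f g k, b (f - g) k = b f k - b g k := fun f g k => by
    simp only [b, _root_.sub_apply, sub_mul]
    exact integral_sub (integrable_mul_schwartz f k) (integrable_mul_schwartz g k)
  have hsmul : ∀ (c : ℂ) f k, b (c • f) k = c * b f k := fun c f k => by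
    simp only [b, _root_.smul_apply, smul_eq_mul, mul_assoc]
    exact integral_const_mul _ _
  have hsum : ∀ (F : Fin d → 𝓢(RSpace d, ℂ)) k, b (∑ l, F l) k = ∑ l, b (F l) k := fun F k => by
    simp only [b, _root_.sum_apply, Finset.sum_mul]
    exact integral_finsetSum _ fun l _ => integrable_mul_schwartz (F l) k
  have hD : ∀ (m : RSpace d) f g, b (∂_{m} f) g = - b f (∂_{m} g) := fun m f g => by
    rw [eq_neg_iff_add_eq_zero, ← eq_neg_iff_add_eq_zero.1
      (integral_mul_lineDerivOp_right_eq_neg_left (μ := volume) f g m), add_comm]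
  have hL : ∀ f g, b (Δ f) g = b f (Δ g) := fun f g =>
    (integral_mul_laplacian_right_eq_left (μ := volume) f g).symm
  have expand : ∀ u v : SchwartzTuple d, ∑ j, b (negLameSub d lam μ z v j) (u j)
      = -(μ : ℂ) * ∑ j, b (Δ (v j)) (u j) + ((lam + μ : ℝ) : ℂ) * ∑ j, ∑ k,
        b (∂_{(EuclideanSpace.single k (1 : ℝ) : RSpace d)} (v k))
          (∂_{(EuclideanSpace.single j (1 : ℝ) : RSpace d)} (u j))
        - z * ∑ j, b (v j) (u j) := by
    intro u v
    simp only [negLameSub_eq_sub, negLame_apply, hsub, hsmul, hD _ (∑ k, _), hsum,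
      Finset.sum_sub_distrib, ← Finset.mul_sum, Finset.sum_neg_distrib]
    ring
  calc ∑ j, b (negLameSub d lam μ z v j) (u j)
      = ∑ j, b (negLameSub d lam μ z u j) (v j) := by
        rw [expand, expand, Finset.sum_comm]
        simp only [hL, hcomm (v _)]
        congr 3
        refine Finset.sum_congr rfl fun k _ => Finset.sum_congr rfl fun j _ => hcomm _ _
    _ = _ := Finset.sum_congr rfl fun j _ => hcomm _ _

theorem exists_schwartz_approx_identity (d : ℕ) :
    ∃ φ : 𝓢(RSpace d, ℂ), ∀ h : 𝓢(RSpace d, ℂ), Filter.Tendsto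
      (fun c : ℝ => ∫ x, (((c ^ d : ℝ) : ℂ) * φ (c • x)) * h x) Filter.atTop (nhds (h 0)) := by
  let f := unitBump d
  let c₀ : ℝ := ∫ x, f x
  have hc₀ : 0 < c₀ := f.integral_pos
  refine ⟨((c₀⁻¹ : ℝ) : ℂ) • bumpSchwartz f, fun h => ?_⟩
  have := tendsto_integral_comp_smul_smul_of_integrable (μ := (volume : Measure (RSpace d)))
    (φ := fun x => c₀⁻¹ * f x) (g := h)
    (fun x => mul_nonneg (by positivity) f.nonneg)
    (by rw [integral_const_mul]; exact inv_mul_cancel₀ hc₀.ne')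
    (by
      refine tendsto_const_nhds.congr' ?_
      have : ∀ᶠ x : RSpace d in Bornology.cobounded _, 2 ≤ ‖x‖ :=
        tendsto_norm_cobounded_atTop.eventually_ge_atTop 2
      filter_upwards [this] with x hx
      rw [f.zero_of_le_dist (by simpa [f, unitBump] using hx)]
      simp)
    h.integrable h.continuous.continuousAt
  refine this.congr fun c => ?_
  congr 1
  ext x
  simp

theorem enorm_integral_mul_le {r : ℝ≥0∞} (hqr : ENNReal.HolderTriple q r 1)
    (f g : 𝓢(RSpace d, ℂ)) :
    ‖∫ x, f x * g x‖ₑ ≤ eLpNorm f q volume * eLpNorm g r volume := by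
  refine (enorm_integral_le_lintegral_enorm _).trans ?_
  rw [← eLpNorm_one_eq_lintegral_enorm]
  exact eLpNorm_smul_le_mul_eLpNorm (f := g) (φ := f) g.continuous.aestronglyMeasurable
    f.continuous.aestronglyMeasurable

theorem AprioriBound.enorm_integral_le (h : AprioriBound d lam μ z 1 q K) {r : ℝ≥0∞}
    (hqr : ENNReal.HolderTriple q r 1)
    (hμ : 0 < μ) (hlam : 0 < lam + 2 * μ) (hz : z ∉ halfLine)
    (g : 𝓢(RSpace d, ℂ)) (u : SchwartzTuple d) (i : Fin d) :
    ‖∫ x, g x * u i x‖ₑ ≤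
      K * eLpNorm g 1 volume * ∑ j, eLpNorm (negLameSub d lam μ z u j) r volume := by
  -- Solving `(-Δ* - z) v = g e_i` turns the pairing of `g` with `u_i` into that of `v` with `(-Δ* -
  -- z) u`; Hölder and the `L¹` to `L^q` estimate for `v` then apply.
  obtain ⟨v, hv⟩ := (negLameSub_bijective (d := d) hμ hlam hz).2 (Pi.single i g)
  have hsum : ∑ j, eLpNorm (negLameSub d lam μ z v j) 1 volume = eLpNorm g 1 volume := by
    rw [hv, Finset.sum_eq_single i, Pi.single_eq_same]
    · intro j _ hj
      rw [Pi.single_eq_of_ne hj]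
      exact eLpNorm_zero
    · simp
  have hI : ∫ x, g x * u i x = ∑ j, ∫ x, v j x * negLameSub d lam μ z u j x := by
    rw [← negLameSub_symm, hv, Finset.sum_eq_single i, Pi.single_eq_same]
    · intro j _ hj
      rw [Pi.single_eq_of_ne hj]
      simp
    · simp
  rw [hI, Finset.mul_sum]
  refine (enorm_sum_le _ _).trans (Finset.sum_le_sum fun j _ => ?_)
  refine (enorm_integral_mul_le hqr _ _).trans ?_
  have := h v j
  rw [hsum] at this
  gcongr

theorem eLpNorm_one_dilation (φ : 𝓢(RSpace d, ℂ)) {c : ℝ} (hc : 0 < c) :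
    eLpNorm (((c ^ d : ℝ) : ℂ) • dilation c hc.ne' φ) 1 volume = eLpNorm φ 1 volume := by
  have h0 : c ^ d ≠ 0 := by positivity
  rw [eLpNorm_smul_schwartz, eLpNorm_dilation c hc, ← mul_assoc,
    enorm_complex_ofReal (by positivity), ← ENNReal.ofReal_mul (by positivity),
    Real.rpow_neg hc.le]
  simp [h0]

/-- The pairings of `u_i` with an approximate identity converge to `u_i(0)`, and its `L¹` norms do
not depend on the scale `c`, so the dual estimate survives the limit. -/
theorem AprioriBound.evalBound_of_dual (h : AprioriBound d lam μ z 1 q K) {r : ℝ≥0∞}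
    (hqr : ENNReal.HolderTriple q r 1)
    (hμ : 0 < μ) (hlam : 0 < lam + 2 * μ) (hz : z ∉ halfLine) :
    ∃ K', EvalBound d lam μ z r K' := by
  obtain ⟨φ, hφ⟩ := exists_schwartz_approx_identity d
  refine ⟨K * (eLpNorm φ 1 volume).toNNReal, fun u i => ?_⟩
  refine le_of_tendsto (hφ (u i)).enorm ?_
  filter_upwards [Filter.eventually_gt_atTop 0] with c hc
  have := h.enorm_integral_le hqr hμ hlam hz (((c ^ d : ℝ) : ℂ) • dilation c hc.ne' φ) u i
  rw [eLpNorm_one_dilation φ hc] at this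
  rwa [ENNReal.coe_mul, ENNReal.coe_toNNReal (eLpNorm_schwartz_ne_top φ 1)]

end Evaluation

/-! ### The endpoint `p = d/2` in dimension at least three -/

section DyadicBumps

variable {d : ℕ} {p : ℝ≥0∞} {lam μ : ℝ} {z : ℂ} {K : ℝ≥0}

theorem lineDerivOp_eventuallyEq_zero (m : RSpace d) {φ : 𝓢(RSpace d, ℂ)} {x : RSpace d} {c : ℂ}
    (h : φ =ᶠ[nhds x] fun _ => c) : (∂_{m} φ : 𝓢(RSpace d, ℂ)) =ᶠ[nhds x] fun _ => 0 := by
  filter_upwards [h.fderiv (𝕜 := ℝ)] with y hy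
  rw [lineDerivOp_apply_eq_fderiv, hy]
  simp

/-- Every second derivative vanishes where `φ` is locally constant. For the unit bump this confines
`-Δ* φ` to the annulus `1 ≤ ‖x‖ ≤ 2`. -/
theorem negLame_const_apply_eq_zero {φ : 𝓢(RSpace d, ℂ)} {x : RSpace d} {c : ℂ}
    (h : φ =ᶠ[nhds x] fun _ => c) (j : Fin d) : negLame d lam μ (fun _ => φ) j x = 0 := by
  have h2 : ∀ m m' : RSpace d, ∂_{m} (∂_{m'} φ) x = 0 := fun m m' =>
    (lineDerivOp_eventuallyEq_zero m (lineDerivOp_eventuallyEq_zero m' h)).self_of_nhds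
  rw [negLame_apply, SchwartzMap.laplacian_eq_sum (EuclideanSpace.basisFun (Fin d) ℝ),
    lineDerivOp_sum]
  simp [h2]

theorem unitBump_eventuallyEq_const {x : RSpace d} (hx : ‖x‖ < 1 ∨ 2 < ‖x‖) :
    ∃ c : ℂ, bumpSchwartz (unitBump d) =ᶠ[nhds x] fun _ => c := by
  rcases hx with hx | hx
  · refine ⟨1, ?_⟩
    filter_upwards [continuous_norm.continuousAt.eventually_lt_const hx] with y hy
    rw [bumpSchwartz_apply, (unitBump d).one_of_mem_closedBall (by simpa [unitBump] using hy.le)]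
    simp
  · refine ⟨0, ?_⟩
    filter_upwards [continuous_norm.continuousAt.eventually_const_lt hx] with y hy
    rw [bumpSchwartz_apply, (unitBump d).zero_of_le_dist (by simpa [unitBump] using hy.le)]
    simp

theorem enorm_sum_rpow_of_disjoint {ι E : Type*} [NormedAddCommGroup E] (s : Finset ι) (a : ι → E)
    {r : ℝ} (hr : 0 < r) (h : ∀ k ∈ s, ∀ l ∈ s, a k ≠ 0 → a l ≠ 0 → k = l) :
    ‖∑ k ∈ s, a k‖ₑ ^ r = ∑ k ∈ s, ‖a k‖ₑ ^ r := by
  by_cases h0 : ∃ k ∈ s, a k ≠ 0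
  · obtain ⟨k, hk, hak⟩ := h0
    have hz : ∀ l ∈ s, l ≠ k → a l = 0 := fun l hl hlk => by
      by_contra hal
      exact hlk (h l hl k hk hal hak)
    rw [Finset.sum_eq_single_of_mem k hk hz, Finset.sum_eq_single_of_mem k hk]
    intro l hl hlk
    simp [hz l hl hlk, hr]
  · push Not at h0
    rw [Finset.sum_eq_zero h0, Finset.sum_eq_zero]
    · simp [hr]
    · intro l hl
      simp [h0 l hl, hr]

/-- Disjoint dilates of a function supported in an annulus, normalised to have the same `L^p` norm
with `p = d / 2`. -/
theorem eLpNorm_sum_dilation_annulus (hd : 0 < d) (hp : p ≠ ∞) (hpd : p.toReal = d / 2)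
    (F : 𝓢(RSpace d, ℂ)) (hF : ∀ x, ‖x‖ < 1 ∨ 2 < ‖x‖ → F x = 0) (N : ℕ) :
    eLpNorm (∑ k ∈ Finset.range N, ((((4 : ℝ) ^ k) ^ 2 : ℝ) : ℂ) •
      dilation ((4 : ℝ) ^ k) (by positivity) F : 𝓢(RSpace d, ℂ)) p volume
      = (N : ℝ≥0∞) ^ (2 / (d : ℝ)) * eLpNorm F p volume := by
  have hd' : (0 : ℝ) < d := by exact_mod_cast hd
  have hr : 0 < p.toReal := by rw [hpd]; positivity
  have hp0 : p ≠ 0 := fun h => by simp [h] at hr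
  let G : ℕ → 𝓢(RSpace d, ℂ) := fun k => ((((4 : ℝ) ^ k) ^ 2 : ℝ) : ℂ) •
      dilation ((4 : ℝ) ^ k) (by positivity) F
  have hG : ∀ k, eLpNorm (G k) p volume = eLpNorm F p volume := by
    intro k
    have h4 : (0 : ℝ) < 4 ^ k := by positivity
    simp only [G]
    rw [eLpNorm_smul_schwartz, eLpNorm_dilation _ h4, ← mul_assoc,
      enorm_complex_ofReal (by positivity), ← ENNReal.ofReal_mul (by positivity)]
    have : (d : ℝ) * p⁻¹.toReal = 2 := by
      rw [ENNReal.toReal_inv, hpd]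
      field_simp
    rw [this, Real.rpow_neg h4.le, Real.rpow_two, mul_inv_cancel₀ (by positivity)]
    simp
  have hGx : ∀ k x, G k x ≠ 0 → 1 ≤ 4 ^ k * ‖x‖ ∧ 4 ^ k * ‖x‖ ≤ 2 := by
    intro k x hx
    by_contra hc
    apply hx
    have hn : ‖((4 : ℝ) ^ k) • x‖ = 4 ^ k * ‖x‖ := by
      rw [norm_smul, Real.norm_of_nonneg (by positivity)]
    have := hF (((4 : ℝ) ^ k) • x) (by
      rw [hn]
      by_contra hc2
      push Not at hc2
      exact hc hc2)
    simp [G, this]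
  -- The dilation ratio `4` exceeds the ratio `2` of the radii: `1 ≤ 4^k ‖x‖` gives `4 ≤ 4^l ‖x‖`,
  -- against `4^l ‖x‖ ≤ 2`.
  have hlt : ∀ k l x, k < l → G k x ≠ 0 → G l x ≠ 0 → False := by
    intro k l x hkl hk hl
    have h1 := (hGx k x hk).1
    have h2 := (hGx l x hl).2
    have h3 : (4 : ℝ) ^ (k + 1) ≤ 4 ^ l := pow_le_pow_right₀ (by norm_num) hkl
    have h5 := mul_le_mul_of_nonneg_right h3 (norm_nonneg x)
    rw [pow_succ] at h5
    linarith
  have hdisj : ∀ x, ∀ k ∈ Finset.range N, ∀ l ∈ Finset.range N, G k x ≠ 0 → G l x ≠ 0 →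
      k = l := by
    intro x k _ l _ hk hl
    rcases lt_trichotomy k l with h | h | h
    · exact (hlt k l x h hk hl).elim
    · exact h
    · exact (hlt l k x h hl hk).elim
  change eLpNorm (∑ k ∈ Finset.range N, G k : 𝓢(RSpace d, ℂ)) p volume = _
  rw [eLpNorm_eq_lintegral_rpow_enorm_toReal hp0 hp]
  have h1 : ∫⁻ x, ‖(∑ k ∈ Finset.range N, G k : 𝓢(RSpace d, ℂ)) x‖ₑ ^ p.toReal
      = ∑ k ∈ Finset.range N, ∫⁻ x, ‖G k x‖ₑ ^ p.toReal := by
    rw [← lintegral_finsetSum]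
    · refine lintegral_congr fun x => ?_
      rw [_root_.sum_apply]
      exact enorm_sum_rpow_of_disjoint _ _ hr (hdisj x)
    · intro k _
      exact ((G k).continuous.measurable.enorm).pow_const _
  have h2 : ∀ k, ∫⁻ x, ‖G k x‖ₑ ^ p.toReal = eLpNorm F p volume ^ p.toReal := by
    intro k
    rw [← hG k, eLpNorm_eq_lintegral_rpow_enorm_toReal hp0 hp, ← ENNReal.rpow_mul,
      one_div_mul_cancel hr.ne', ENNReal.rpow_one]
  rw [h1, Finset.sum_congr rfl fun k _ => h2 k, Finset.sum_const, Finset.card_range, nsmul_eq_mul,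
    ENNReal.mul_rpow_of_nonneg _ _ (by positivity), ← ENNReal.rpow_mul, mul_one_div_cancel hr.ne',
    ENNReal.rpow_one, hpd, one_div_div]

/-- Without the factor `4^{2k}` the `k`-th norm is `16^{-k}` times that of `φ`. The triangle
inequality and the cruder ratio `1/2` give the constant `2`; no disjointness is needed. -/
theorem eLpNorm_sum_dilation_le (hd : 0 < d) (hp1 : 1 ≤ p) (hpd : p.toReal = d / 2)
    (φ : 𝓢(RSpace d, ℂ)) (N : ℕ) :
    eLpNorm (∑ k ∈ Finset.range N, dilation ((4 : ℝ) ^ k) (by positivity) φ : 𝓢(RSpace d, ℂ))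
      p volume ≤ 2 * eLpNorm φ p volume := by
  have hd' : (0 : ℝ) < d := by exact_mod_cast hd
  have h1 : eLpNorm (∑ k ∈ Finset.range N, dilation ((4 : ℝ) ^ k) (by positivity) φ :
      𝓢(RSpace d, ℂ)) p volume ≤ ∑ k ∈ Finset.range N,
        eLpNorm (dilation ((4 : ℝ) ^ k) (by positivity) φ) p volume := by
    have h0 : ⇑(∑ k ∈ Finset.range N, dilation ((4 : ℝ) ^ k) (by positivity) φ : 𝓢(RSpace d, ℂ))
        = ∑ k ∈ Finset.range N, ⇑(dilation ((4 : ℝ) ^ k) (by positivity) φ) := by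
      ext x
      simp [_root_.sum_apply]
    rw [h0]
    exact eLpNorm_sum_le (fun k _ => (SchwartzMap.continuous _).aestronglyMeasurable) hp1
  refine h1.trans ?_
  have h2 : ∀ k ∈ Finset.range N, eLpNorm (dilation ((4 : ℝ) ^ k) (by positivity) φ) p volume
      ≤ ENNReal.ofReal ((1 / 2) ^ k) * eLpNorm φ p volume := by
    intro k _
    have h4 : (0 : ℝ) < 4 ^ k := by positivity
    rw [eLpNorm_dilation _ h4]
    gcongr
    have : (d : ℝ) * p⁻¹.toReal = 2 := by
      rw [ENNReal.toReal_inv, hpd]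
      field_simp
    rw [this, Real.rpow_neg h4.le, Real.rpow_two, ← pow_mul, mul_comm k, pow_mul, ← inv_pow]
    gcongr
    norm_num
  refine (Finset.sum_le_sum h2).trans ?_
  rw [← Finset.sum_mul, ← ENNReal.ofReal_sum_of_nonneg (fun _ _ => by positivity)]
  gcongr
  rw [← ENNReal.ofReal_ofNat]
  refine ENNReal.ofReal_le_ofReal ?_
  exact (summable_geometric_two.sum_le_tsum _ (fun _ _ => by positivity)).trans_eq
    tsum_geometric_two

theorem not_evalBound_half_dim (hd : 3 ≤ d) (hp1 : 1 ≤ p) (hp : p ≠ ∞) (hpd : p.toReal = d / 2) :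
    ¬ EvalBound d lam μ z p K := by
  intro h
  have hd0 : 0 < d := by omega
  have hd' : (3 : ℝ) ≤ d := by exact_mod_cast hd
  let φ : 𝓢(RSpace d, ℂ) := bumpSchwartz (unitBump d)
  let F : SchwartzTuple d := negLame d lam μ (fun _ => φ)
  let w : ℕ → 𝓢(RSpace d, ℂ) := fun N =>
    ∑ k ∈ Finset.range N, dilation ((4 : ℝ) ^ k) (by positivity) φ
  have hw0 : ∀ N, w N 0 = N := by
    intro N
    have h1 : φ 0 = 1 := by
      simp only [φ]
      rw [bumpSchwartz_apply, (unitBump d).one_of_mem_closedBall (by simp [unitBump])]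
      simp
    simp [w, _root_.sum_apply, h1]
  have hLw : ∀ N j, negLame d lam μ (fun _ => w N) j =
      ∑ k ∈ Finset.range N, ((((4 : ℝ) ^ k) ^ 2 : ℝ) : ℂ) •
        dilation ((4 : ℝ) ^ k) (by positivity) (F j) := by
    intro N j
    have h1 : (fun _ => w N : SchwartzTuple d) =
        ∑ k ∈ Finset.range N, fun _ => dilation ((4 : ℝ) ^ k) (by positivity) φ := by
      ext1 i
      simp [w, Finset.sum_apply]
    rw [h1, map_sum, Finset.sum_apply]
    exact Finset.sum_congr rfl fun k _ => negLame_dilation _ _ _ _ _ _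
  have hF : ∀ j x, ‖x‖ < 1 ∨ 2 < ‖x‖ → F j x = 0 := by
    intro j x hx
    obtain ⟨c, hc⟩ := unitBump_eventuallyEq_const hx
    exact negLame_const_apply_eq_zero hc j
  let A : ℝ≥0∞ := K * ∑ j, eLpNorm (F j) p volume
  let B : ℝ≥0∞ := K * ∑ j : Fin d, ‖z‖ₑ * (2 * eLpNorm φ p volume)
  have hA : A ≠ ∞ := ENNReal.mul_ne_top ENNReal.coe_ne_top
    (ENNReal.sum_ne_top.2 fun j _ => eLpNorm_schwartz_ne_top _ _)
  have hB : B ≠ ∞ := ENNReal.mul_ne_top ENNReal.coe_ne_top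
    (ENNReal.sum_ne_top.2 fun j _ => ENNReal.mul_ne_top enorm_ne_top
      (ENNReal.mul_ne_top (by simp) (eLpNorm_schwartz_ne_top _ _)))
  have key : ∀ N : ℕ, (N : ℝ≥0∞) ≤ (N : ℝ≥0∞) ^ (2 / (d : ℝ)) * A + B := by
    intro N
    have h1 := h (fun _ => w N) ⟨0, hd0⟩
    simp only [hw0] at h1
    have h2 : ∀ j, eLpNorm (negLameSub d lam μ z (fun _ => w N) j) p volume ≤
        (N : ℝ≥0∞) ^ (2 / (d : ℝ)) * eLpNorm (F j) p volume
          + ‖z‖ₑ * (2 * eLpNorm φ p volume) := by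
      intro j
      refine (eLpNorm_negLameSub_le hp1 _ j).trans ?_
      rw [hLw, eLpNorm_sum_dilation_annulus hd0 hp hpd (F j) (hF j) N]
      gcongr
      exact eLpNorm_sum_dilation_le hd0 hp1 hpd φ N
    calc (N : ℝ≥0∞) = ‖(N : ℂ)‖ₑ := by simp [← ofReal_norm]
      _ ≤ _ := h1
      _ ≤ K * ∑ j, ((N : ℝ≥0∞) ^ (2 / (d : ℝ)) * eLpNorm (F j) p volume
          + ‖z‖ₑ * (2 * eLpNorm φ p volume)) := by
        gcongr with j
        exact h2 j
      _ = _ := by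
        rw [Finset.sum_add_distrib, ← Finset.mul_sum, mul_add, mul_left_comm]
  have key' : ∀ N : ℕ, (N : ℝ) ≤ (N : ℝ) ^ (2 / (d : ℝ)) * A.toReal + B.toReal := by
    intro N
    have hfin : (N : ℝ≥0∞) ^ (2 / (d : ℝ)) * A ≠ ∞ :=
      ENNReal.mul_ne_top (ENNReal.rpow_ne_top_of_nonneg (by positivity) (by simp)) hA
    have := ENNReal.toReal_mono (ENNReal.add_ne_top.2 ⟨hfin, hB⟩) (key N)
    rwa [ENNReal.toReal_add hfin hB, ENNReal.toReal_mul, ← ENNReal.toReal_rpow,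
      ENNReal.toReal_natCast] at this
  -- Here `d ≥ 3` is essential: `N^{1 - 2/d}` must be unbounded to exceed `A + B`.
  have he : 0 < 1 - 2 / (d : ℝ) := by
    rw [sub_pos, div_lt_one (by linarith)]
    linarith
  have ht := (tendsto_rpow_atTop he).comp tendsto_natCast_atTop_atTop
  obtain ⟨N, hN, hN1⟩ := ((ht.eventually_gt_atTop (A.toReal + B.toReal)).and
    (Filter.eventually_ge_atTop 1)).exists
  have hN0 : (1 : ℝ) ≤ N := by exact_mod_cast hN1
  have hNp : (0 : ℝ) < N := by linarith
  have h1 : (1 : ℝ) ≤ (N : ℝ) ^ (2 / (d : ℝ)) := Real.one_le_rpow hN0 (by positivity)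
  have h2 : (N : ℝ) = (N : ℝ) ^ (2 / (d : ℝ)) * (N : ℝ) ^ (1 - 2 / (d : ℝ)) := by
    rw [← Real.rpow_add hNp]
    simp
  have h3 := key' N
  have h4 : (N : ℝ) ^ (2 / (d : ℝ)) * (A.toReal + B.toReal)
      < (N : ℝ) ^ (2 / (d : ℝ)) * (N : ℝ) ^ (1 - 2 / (d : ℝ)) :=
    mul_lt_mul_of_pos_left hN (by linarith)
  have h5 : B.toReal ≤ (N : ℝ) ^ (2 / (d : ℝ)) * B.toReal :=
    le_mul_of_one_le_left ENNReal.toReal_nonneg h1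
  linarith

end DyadicBumps

/-! ### The endpoint `(1, 0)` in the plane -/

section LogarithmicDivergence

theorem fourier_dilation {d : ℕ} {c : ℝ} (hc : 0 < c) (g : 𝓢(RSpace d, ℂ)) (ξ : RSpace d) :
    𝓕 (((c ^ d : ℝ) : ℂ) • dilation c hc.ne' g) ξ = 𝓕 g (c⁻¹ • ξ) := by
  rw [fourier_coe, fourier_coe, Real.fourier_eq, Real.fourier_eq]
  have h1 := Measure.integral_comp_smul (volume : Measure (RSpace d))
    (fun y => Real.fourierChar (-inner ℝ y (c⁻¹ • ξ)) • g y) c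
  have h2 : ∀ x : RSpace d, inner ℝ (c • x) (c⁻¹ • ξ) = inner ℝ x ξ := fun x => by
    rw [real_inner_smul_left, real_inner_smul_right, mul_inv_cancel_left₀ hc.ne']
  simp only [h2, finrank_euclideanSpace, Fintype.card_fin] at h1
  have h3 : 0 < (c ^ d)⁻¹ := by positivity
  rw [abs_of_pos h3] at h1
  have h4 : ∀ x : RSpace d, Real.fourierChar (-inner ℝ x ξ) •
      (((c ^ d : ℝ) : ℂ) • dilation c hc.ne' g) x
      = ((c ^ d : ℝ) : ℂ) * (Real.fourierChar (-inner ℝ x ξ) • g (c • x)) := fun x => by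
    simp only [_root_.smul_apply, dilation_apply, smul_eq_mul, Circle.smul_def]
    ring
  simp only [h4]
  rw [integral_const_mul, h1, Complex.real_smul, ← mul_assoc, ← Complex.ofReal_mul,
    mul_inv_cancel₀ (by positivity)]
  simp

theorem schwartz_apply_zero_eq_integral_fourier {d : ℕ} (f : 𝓢(RSpace d, ℂ)) :
    f 0 = ∫ ξ, 𝓕 f ξ := by
  have h : (𝓕⁻ (𝓕 f : 𝓢(RSpace d, ℂ)) : 𝓢(RSpace d, ℂ)) 0 = f 0 := by
    rw [FourierTransform.fourierInv_fourier_eq]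
  rw [← h, fourierInv_coe, Real.fourierInv_eq]
  simp

/-- In polar coordinates the integrand becomes `κ r⁻² · r = κ / r`, which is not integrable at
infinity. -/
theorem not_integrable_indicator_norm_inv_sq {κ R : ℝ} (hκ : 0 < κ) (hR : 0 < R) :
    ¬ Integrable (fun x : RSpace 2 => (Set.Ioi R).indicator (fun r => κ * (r ^ 2)⁻¹) ‖x‖)
      volume := by
  intro h
  rw [integrable_fun_norm_addHaar volume
    (f := (Set.Ioi R).indicator (fun r => κ * (r ^ 2)⁻¹))] at h
  apply not_integrableOn_Ioi_inv (a := R)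
  have h1 := (h.mono_set (Set.Ioi_subset_Ioi hR.le)).const_mul κ⁻¹
  refine IntegrableOn.congr_fun h1 (fun r hr => ?_) measurableSet_Ioi
  have hr0 : r ≠ 0 := (hR.trans hr).ne'
  simp only [finrank_euclideanSpace, Fintype.card_fin, Set.indicator_of_mem hr, smul_eq_mul]
  field_simp
  simp

/-- If `h` decays no faster than `|ξ|⁻²` on the plane, its cut-off integrals are unbounded. -/
theorem not_bounded_integral_cutoff {h : RSpace 2 → ℝ} (hc : Continuous h) {κ R : ℝ}
    (hκ : 0 < κ) (hR : 0 < R) (hh : ∀ ξ, R < ‖ξ‖ → κ * (‖ξ‖ ^ 2)⁻¹ ≤ h ξ) (M : ℝ) :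
    ¬ ∀ n : ℕ, 0 < n → ∫ ξ, unitBump 2 ((n : ℝ)⁻¹ • ξ) * h ξ ≤ M := by
  intro hM
  apply not_integrable_indicator_norm_inv_sq hκ hR
  set F : RSpace 2 → ℝ := fun x => (Set.Ioi R).indicator (fun r => κ * (r ^ 2)⁻¹) ‖x‖ with hFdef
  have hF0 : ∀ x, 0 ≤ F x := fun x => Set.indicator_nonneg (fun r _ => by positivity) _
  have hFm : Measurable F :=
    (Measurable.indicator (by fun_prop) measurableSet_Ioi).comp measurable_norm
  have hFb : ∀ x, F x ≤ κ * (R ^ 2)⁻¹ := by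
    intro x
    refine Set.indicator_apply_le' (fun hx => ?_) (fun _ => by positivity)
    have : R < ‖x‖ := hx
    gcongr
  have hFI : ∀ n : ℕ, IntegrableOn F (Metric.closedBall 0 (n : ℝ)) volume := by
    intro n
    refine Measure.integrableOn_of_bounded (M := κ * (R ^ 2)⁻¹)
      (measure_closedBall_lt_top).ne hFm.aestronglyMeasurable ?_
    exact Filter.Eventually.of_forall fun x => by
      rw [Real.norm_of_nonneg (hF0 x)]
      exact hFb x
  obtain ⟨C, hC⟩ := (isCompact_closedBall (0 : RSpace 2) R).exists_bound_of_continuousOn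
    hc.continuousOn
  have hC0 : 0 ≤ C := (norm_nonneg _).trans (hC 0 (by simp [hR.le]))
  -- On the ball of radius `R` the sign of `h` is unknown; adding `C` there keeps the cut-off
  -- integrand nonnegative, at the cost of a constant independent of `n`.
  let D : RSpace 2 → ℝ := (Metric.closedBall 0 R).indicator fun _ => C
  have hDI : Integrable D volume :=
    (integrable_indicator_iff Metric.isClosed_closedBall.measurableSet).2
      (integrableOn_const (measure_closedBall_lt_top).ne)
  refine (aecover_closedBall (x := (0 : RSpace 2)) (tendsto_natCast_atTop_atTop (R := ℝ))
    ).integrable_of_integral_bounded_of_nonneg_ae (M + ∫ x, D x) hFI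
    (Filter.Eventually.of_forall hF0) ?_
  filter_upwards [Filter.eventually_gt_atTop 0] with n hn
  have hn0 : (0 : ℝ) < n := by exact_mod_cast hn
  let B : RSpace 2 → ℝ := fun ξ => unitBump 2 ((n : ℝ)⁻¹ • ξ)
  have hBc : Continuous B := (unitBump 2).continuous.comp (continuous_const_smul _)
  have hBs : HasCompactSupport B :=
    (unitBump 2).hasCompactSupport.comp_homeomorph (Homeomorph.smulOfNeZero (n : ℝ)⁻¹
      (inv_ne_zero hn0.ne'))
  have hBI : Integrable (fun ξ => B ξ * h ξ) volume :=
    (hBc.mul hc).integrable_of_hasCompactSupport hBs.mul_right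
  have hle : ∀ x, (Metric.closedBall (0 : RSpace 2) (n : ℝ)).indicator F x ≤ B x * h x + D x := by
    intro x
    by_cases hx : ‖x‖ ≤ R
    · have h1 : F x = 0 := Set.indicator_of_notMem (by simpa using hx) _
      have h2 : D x = C := Set.indicator_of_mem (by simpa using hx) _
      have h3 : (Metric.closedBall (0 : RSpace 2) (n : ℝ)).indicator F x = 0 := by
        by_cases hxn : x ∈ Metric.closedBall (0 : RSpace 2) (n : ℝ)
        · rw [Set.indicator_of_mem hxn, h1]
        · exact Set.indicator_of_notMem hxn _
      rw [h3, h2]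
      have h4 : |B x * h x| ≤ 1 * C := by
        rw [abs_mul]
        gcongr
        · rw [abs_of_nonneg (unitBump 2).nonneg]
          exact (unitBump 2).le_one
        · exact hC x (by simpa using hx)
      have := (abs_le.1 h4).1
      linarith
    · have hx' : R < ‖x‖ := not_le.1 hx
      have h2 : D x = 0 := Set.indicator_of_notMem (by simpa using hx') _
      have h5 : F x = κ * (‖x‖ ^ 2)⁻¹ := Set.indicator_of_mem (by simpa using hx') _
      have h6 := hh x hx'
      have h7 : 0 ≤ h x := le_trans (by positivity) h6
      rw [h2, add_zero]
      by_cases hxn : x ∈ Metric.closedBall (0 : RSpace 2) (n : ℝ)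
      · have h8 : B x = 1 := by
          refine (unitBump 2).one_of_mem_closedBall ?_
          rw [mem_closedBall_zero_iff] at hxn ⊢
          rw [norm_smul, norm_inv, Real.norm_of_nonneg hn0.le]
          change (n : ℝ)⁻¹ * ‖x‖ ≤ 1
          rw [inv_mul_le_iff₀ hn0]
          simpa using hxn
        rw [Set.indicator_of_mem hxn, h8, h5, one_mul]
        exact h6
      · rw [Set.indicator_of_notMem hxn]
        exact mul_nonneg (unitBump 2).nonneg h7
  rw [← integral_indicator Metric.isClosed_closedBall.measurableSet]
  calc ∫ x, (Metric.closedBall (0 : RSpace 2) (n : ℝ)).indicator F x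
      ≤ ∫ x, (B x * h x + D x) :=
        integral_mono ((integrable_indicator_iff Metric.isClosed_closedBall.measurableSet).2
          (hFI n)) (hBI.add hDI) hle
    _ = (∫ x, B x * h x) + ∫ x, D x := integral_add hBI hDI
    _ ≤ M + ∫ x, D x := by
        have := hM n hn
        gcongr

/-- The threshold means `α t ≥ 2‖z‖ + 1`, so `w = α t - z` has `Re w ≥ α t / 2` and `‖w‖ ≤ 2 α t`.
Since `Re w⁻¹ = Re w / ‖w‖²`, the constant is `(1/2) / 4 = 1/8`. -/
theorem re_symbol_inv_ge {α : ℝ} (hα : 0 < α) (z : ℂ) {t : ℝ} (ht : (2 * ‖z‖ + 1) / α ≤ t) :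
    1 / (8 * α) * t⁻¹ ≤ ((((α * t : ℝ) : ℂ) - z)⁻¹).re := by
  rw [div_le_iff₀ hα] at ht
  have hz := norm_nonneg z
  have hs : 0 < α * t := by linarith [mul_comm α t]
  have ht0 : 0 < t := (mul_pos_iff_of_pos_left hα).1 hs
  set w : ℂ := ((α * t : ℝ) : ℂ) - z with hw
  have h1 : α * t / 2 ≤ w.re := by
    have := Complex.re_le_norm z
    rw [hw, Complex.sub_re, Complex.ofReal_re]
    linarith [mul_comm α t]
  have h2 : ‖w‖ ≤ 2 * (α * t) := by
    refine (norm_sub_le _ _).trans ?_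
    rw [Complex.norm_real, Real.norm_of_nonneg hs.le]
    linarith [mul_comm α t]
  have h3 : Complex.normSq w ≤ (2 * (α * t)) ^ 2 := by
    rw [Complex.normSq_eq_norm_sq]
    gcongr
  have h4 : 0 < Complex.normSq w := by
    rw [Complex.normSq_pos]
    intro h0
    rw [h0] at h1
    simp at h1
    linarith
  rw [Complex.inv_re]
  calc 1 / (8 * α) * t⁻¹ = (α * t / 2) / (2 * (α * t)) ^ 2 := by
        field_simp
        norm_num
    _ ≤ w.re / Complex.normSq w :=
        div_le_div₀ ((half_pos hs).le.trans h1) h1 h4 h3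

/-- The Fourier transform of the trace of the resolvent applied to `g` times the identity. -/
theorem fourier_trace_resolvent {d : ℕ} {lam μ : ℝ} {z : ℂ} (hμ : 0 < μ)
    (hlam : 0 < lam + 2 * μ) (hz : z ∉ halfLine) {g : 𝓢(RSpace d, ℂ)}
    {U : Fin d → SchwartzTuple d} (hU : ∀ i, negLameSub d lam μ z (U i) = Pi.single i g)
    (ξ : RSpace d) :
    ∑ i, 𝓕 (U i i) ξ = 𝓕 g ξ *
      (((d : ℂ) - 1) * (((μ * (2 * Real.pi) ^ 2 * ‖ξ‖ ^ 2 : ℝ) : ℂ) - z)⁻¹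
        + ((((lam + 2 * μ) * (2 * Real.pi) ^ 2 * ‖ξ‖ ^ 2 : ℝ) : ℂ) - z)⁻¹) := by
  have hA : (((μ * (2 * Real.pi) ^ 2 * ‖ξ‖ ^ 2 : ℝ) : ℂ) - z) ≠ 0 :=
    symbol_ne_zero hz (by positivity)
  have hB : ((((lam + 2 * μ) * (2 * Real.pi) ^ 2 * ‖ξ‖ ^ 2 : ℝ) : ℂ) - z) ≠ 0 :=
    symbol_ne_zero hz (by positivity)
  have hBA : ((((lam + 2 * μ) * (2 * Real.pi) ^ 2 * ‖ξ‖ ^ 2 : ℝ) : ℂ) - z)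
      = (((μ * (2 * Real.pi) ^ 2 * ‖ξ‖ ^ 2 : ℝ) : ℂ) - z) +
        (((lam + μ) * (2 * Real.pi) ^ 2 : ℝ) : ℂ) * ∑ k, (ξ k : ℂ) * ξ k := by
    rw [sum_sq_eq_norm_sq]
    push_cast
    ring
  have key : ∀ i j, (if j = i then 𝓕 g ξ else 0)
      = (((μ * (2 * Real.pi) ^ 2 * ‖ξ‖ ^ 2 : ℝ) : ℂ) - z) * 𝓕 (U i j) ξ
      + (((lam + μ) * (2 * Real.pi) ^ 2 : ℝ) : ℂ) * ξ j * ∑ k, ξ k * 𝓕 (U i k) ξ := by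
    intro i j
    rw [← fourier_negLameSub, hU]
    split_ifs with h
    · rw [h, Pi.single_eq_same]
    · rw [Pi.single_eq_of_ne h]
      have : 𝓕 (0 : 𝓢(RSpace d, ℂ)) = 0 := (fourierCLM ℂ 𝓢(RSpace d, ℂ)).map_zero
      simp [this]
  generalize (((μ * (2 * Real.pi) ^ 2 * ‖ξ‖ ^ 2 : ℝ) : ℂ) - z) = A at *
  generalize ((((lam + 2 * μ) * (2 * Real.pi) ^ 2 * ‖ξ‖ ^ 2 : ℝ) : ℂ) - z) = B at *
  generalize (((lam + μ) * (2 * Real.pi) ^ 2 : ℝ) : ℂ) = c at *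
  generalize 𝓕 g ξ = γ at *
  set S : ℂ := ∑ k, (ξ k : ℂ) * ξ k
  -- Contracting the system with `ξ` makes it scalar: `ξ` is an eigenvector of the symbol, with
  -- eigenvalue `A + c |ξ|² = B`.
  have hdiv : ∀ i, ∑ k, ξ k * 𝓕 (U i k) ξ = ξ i * γ * B⁻¹ := by
    intro i
    rw [eq_mul_inv_iff_mul_eq₀ hB]
    have h := Finset.sum_congr rfl fun (j : Fin d) (_ : j ∈ Finset.univ) =>
      congrArg (fun w => (ξ j : ℂ) * w) (key i j)
    simp only [mul_ite, mul_zero, Finset.sum_ite_eq', Finset.mem_univ, if_true] at h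
    rw [h, hBA]
    generalize hG : ∑ k, (ξ k : ℂ) * 𝓕 (U i k) ξ = G
    have h2 : ∀ j, (ξ j : ℂ) * (A * 𝓕 (U i j) ξ + c * ξ j * G)
        = A * (ξ j * 𝓕 (U i j) ξ) + c * G * (ξ j * ξ j) := fun j => by ring
    simp only [h2, Finset.sum_add_distrib, ← Finset.mul_sum]
    rw [hG]
    ring
  have htr : S * c * γ * B⁻¹ + A * ∑ i, 𝓕 (U i i) ξ = d * γ := by
    have h := Finset.sum_congr rfl fun (j : Fin d) (_ : j ∈ Finset.univ) => key j j
    simp only [if_true, Finset.sum_const, Finset.card_univ, Fintype.card_fin, nsmul_eq_mul, hdiv,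
      Finset.sum_add_distrib, ← Finset.mul_sum] at h
    rw [h, add_comm]
    congr 1
    simp only [S, Finset.sum_mul]
    exact Finset.sum_congr rfl fun k _ => by ring
  have hcS : c * S = B - A := by rw [hBA]; ring
  have h1 : A * ∑ i, 𝓕 (U i i) ξ = d * γ - (B - A) * γ * B⁻¹ := by
    rw [← hcS, ← htr]
    ring
  rw [← mul_right_inj' hA, h1]
  field_simp
  ring

/-- The trace leaves the radial symbol `H`, a sum of two terms whose real parts are both positive
for large `ξ`, so nothing can cancel. The assumed bound at `0` would keep its cut-off integrals
bounded. -/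
theorem not_evalBound_two {lam μ : ℝ} {z : ℂ} {K : ℝ≥0} (hμ : 0 < μ) (hlam : 0 < lam + 2 * μ)
    (hz : z ∉ halfLine) : ¬ EvalBound 2 lam μ z 1 K := by
  intro hE
  let χ : 𝓢(RSpace 2, ℂ) := bumpSchwartz (unitBump 2)
  -- The `L¹`-normalised dilates of this `g` have Fourier transform `χ(ξ / n)`, exactly the cut-off
  -- needed.
  let g : 𝓢(RSpace 2, ℂ) := 𝓕⁻ χ
  have hg : (𝓕 g : 𝓢(RSpace 2, ℂ)) = χ := FourierTransform.fourier_fourierInv_eq χ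
  let α := μ * (2 * Real.pi) ^ 2
  let β := (lam + 2 * μ) * (2 * Real.pi) ^ 2
  have hα : 0 < α := by positivity
  have hβ : 0 < β := by positivity
  let H : RSpace 2 → ℂ := fun ξ =>
    (((α * ‖ξ‖ ^ 2 : ℝ) : ℂ) - z)⁻¹ + (((β * ‖ξ‖ ^ 2 : ℝ) : ℂ) - z)⁻¹
  have hHc : Continuous H :=
    (hasTemperateGrowth_symbol_inv hz hα).1.continuous.add
      (hasTemperateGrowth_symbol_inv hz hβ).1.continuous
  -- The `1` ensures `‖ξ‖ ≤ ‖ξ‖²` beyond `R`, so the thresholds for `t = ‖ξ‖²` are met.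
  let R := max 1 (max ((2 * ‖z‖ + 1) / α) ((2 * ‖z‖ + 1) / β))
  have hR : 0 < R := lt_of_lt_of_le one_pos (le_max_left _ _)
  have hlow : ∀ ξ : RSpace 2, R < ‖ξ‖ → 1 / (8 * α) * (‖ξ‖ ^ 2)⁻¹ ≤ (H ξ).re := by
    intro ξ hξ
    have h1 : 1 ≤ ‖ξ‖ := (le_max_left _ _).trans hξ.le
    have h2 : ‖ξ‖ ≤ ‖ξ‖ ^ 2 := by nlinarith
    have h3 : max ((2 * ‖z‖ + 1) / α) ((2 * ‖z‖ + 1) / β) ≤ ‖ξ‖ ^ 2 :=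
      (le_max_right _ _).trans (hξ.le.trans h2)
    have h4 := re_symbol_inv_ge hα z ((le_max_left _ _).trans h3)
    have h5 := re_symbol_inv_ge hβ z ((le_max_right _ _).trans h3)
    have h6 : 0 ≤ 1 / (8 * β) * (‖ξ‖ ^ 2)⁻¹ := by positivity
    simp only [H, Complex.add_re]
    linarith
  let M : ℝ≥0∞ := ∑ _i : Fin 2, K * eLpNorm g 1 volume
  have hMtop : M ≠ ∞ := ENNReal.sum_ne_top.2 fun _ _ =>
    ENNReal.mul_ne_top ENNReal.coe_ne_top (eLpNorm_schwartz_ne_top _ _)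
  refine not_bounded_integral_cutoff (Complex.continuous_re.comp hHc) (by positivity) hR hlow
    M.toReal fun n hn => ?_
  have hn0 : (0 : ℝ) < n := by exact_mod_cast hn
  let gn : 𝓢(RSpace 2, ℂ) := (((n : ℝ) ^ 2 : ℝ) : ℂ) • dilation (n : ℝ) hn0.ne' g
  have hgn : eLpNorm gn 1 volume = eLpNorm g 1 volume := eLpNorm_one_dilation g hn0
  have hFgn : ∀ ξ, 𝓕 gn ξ = χ ((n : ℝ)⁻¹ • ξ) := fun ξ => by
    rw [← hg]
    exact fourier_dilation hn0 g ξ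
  choose U hU using fun i => (negLameSub_bijective (d := 2) hμ hlam hz).2 (Pi.single i gn)
  have htr := fourier_trace_resolvent hμ hlam hz hU
  have hbound : ∀ i, ‖U i i 0‖ₑ ≤ K * eLpNorm g 1 volume := by
    intro i
    refine (hE (U i) i).trans_eq ?_
    rw [hU, Finset.sum_eq_single i, Pi.single_eq_same, hgn]
    · intro j _ hj
      rw [Pi.single_eq_of_ne hj]
      exact eLpNorm_zero
    · simp
  have hsum : ∑ i, U i i 0 = ∫ ξ, χ ((n : ℝ)⁻¹ • ξ) * H ξ := by
    simp only [schwartz_apply_zero_eq_integral_fourier]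
    rw [← integral_finsetSum _ fun i _ => (𝓕 (U i i) : 𝓢(RSpace 2, ℂ)).integrable]
    refine integral_congr_ae (Filter.Eventually.of_forall fun ξ => ?_)
    change ∑ i, 𝓕 (U i i) ξ = _
    rw [htr ξ, hFgn]
    simp only [H, α, β]
    norm_num
  have hI : Integrable (fun ξ => χ ((n : ℝ)⁻¹ • ξ) * H ξ) volume := by
    have hBc : Continuous fun ξ : RSpace 2 => χ ((n : ℝ)⁻¹ • ξ) :=
      χ.continuous.comp (continuous_const_smul _)
    have hs : HasCompactSupport χ :=
      (unitBump 2).hasCompactSupport.comp_left (g := fun t : ℝ => (t : ℂ)) Complex.ofReal_zero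
    have hBs : HasCompactSupport fun ξ : RSpace 2 => χ ((n : ℝ)⁻¹ • ξ) :=
      hs.comp_homeomorph (Homeomorph.smulOfNeZero (n : ℝ)⁻¹ (inv_ne_zero hn0.ne'))
    exact (hBc.mul hHc).integrable_of_hasCompactSupport hBs.mul_right
  have hre : ∫ ξ, unitBump 2 ((n : ℝ)⁻¹ • ξ) * (H ξ).re = (∑ i, U i i 0).re := by
    rw [hsum]
    have := integral_re (𝕜 := ℂ) hI
    refine Eq.trans ?_ this
    congr 1
    ext ξ
    simp [χ]
  have hle : ‖∑ i, U i i 0‖ₑ ≤ M :=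
    (enorm_sum_le _ _).trans (Finset.sum_le_sum fun i _ => hbound i)
  change ∫ ξ, unitBump 2 ((n : ℝ)⁻¹ • ξ) * (H ξ).re ≤ _
  rw [hre]
  refine (Complex.re_le_norm _).trans ?_
  rw [← toReal_enorm]
  exact ENNReal.toReal_mono hMtop hle

end LogarithmicDivergence

end

/-! ### Assembly of the cases -/

theorem proposition1p1 (d : ℕ) (hd : 2 ≤ d) (lam μ : ℝ) (hμ : 0 < μ) (hlam : 0 < lam + 2 * μ)
    (hne : μ ≠ lam + 2 * μ) (p q : ℝ≥0∞) (hp : 1 ≤ p) (hq : 1 ≤ q)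
    (hpq : (p⁻¹.toReal, q⁻¹.toReal) ∉ admissibleSet d) (z : ℂ) (hz : z ∉ halfLine) :
    opNormLpLq p q (lameResolvent d hμ hlam hz) = ∞ := by
  by_contra hT
  obtain ⟨K, hK⟩ := exists_aprioriBound hμ hlam hz hp hq hT
  obtain ⟨h0, h2⟩ := hK.scaling_range (by omega) hp hq
  have hunit : ∀ r : ℝ≥0∞, 1 ≤ r → r⁻¹.toReal ∈ Set.Icc (0 : ℝ) 1 := fun r hr =>
    ⟨ENNReal.toReal_nonneg, by
      simpa using ENNReal.toReal_mono ENNReal.one_ne_top (ENNReal.inv_le_one.2 hr)⟩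
  have hval : ∀ r : ℝ≥0∞, 1 ≤ r → r⁻¹ = ENNReal.ofReal r⁻¹.toReal := fun r hr =>
    (ENNReal.ofReal_toReal (ne_top_of_le_ne_top ENNReal.one_ne_top (ENNReal.inv_le_one.2 hr))).symm
  have hone : p⁻¹.toReal = 1 → p = 1 := fun h => by
    have := hval p hp
    rwa [h, ENNReal.ofReal_one, ENNReal.inv_eq_one] at this
  have htop : q⁻¹.toReal = 0 → q = ∞ := fun h => by
    have := hval q hq
    rwa [h, ENNReal.ofReal_zero, ENNReal.inv_eq_zero] at this
  have hpI := hunit p hp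
  have hqI := hunit q hq
  by_cases hd2 : d = 2
  · subst hd2
    simp only [admissibleSet, if_true, Set.mem_ofPred_eq, Set.mem_prod, not_and] at hpq
    -- In the plane failure of admissibility now means `1/p - 1/q ≥ 1`, which in the unit square
    -- leaves only `p = 1`, `q = ∞`.
    have h3 := not_lt.1 (hpq ⟨hpI, hqI⟩ h0)
    have hp1 := hone (le_antisymm hpI.2 (by linarith [hqI.1]))
    have hq1 := htop (le_antisymm (by linarith [hpI.2]) hqI.1)
    subst hp1 hq1
    exact not_evalBound_two hμ hlam hz hK.evalBound
  · have hd3 : 3 ≤ d := by omega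
    have hd3' : (3 : ℝ) ≤ d := by exact_mod_cast hd3
    simp only [admissibleSet, hd2, if_false, Set.mem_sdiff, Set.mem_ofPred_eq, Set.mem_prod,
      Set.mem_insert_iff, Set.mem_singleton_iff, Prod.mk.injEq, not_and, not_not] at hpq
    -- The scaling inequalities hold, so the point must be one of the two removed corners.
    rcases hpq ⟨⟨hpI, hqI⟩, h0, h2⟩ with ⟨h1, h3⟩ | ⟨h1, h3⟩
    · have hp1 := hone h1
      subst hp1
      have hr0 : (0 : ℝ) < d / 2 := by positivity
      -- At this corner `1/q = 1 - 2/d`, so the conjugate exponent of `q` is `d/2`.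
      have hr : ENNReal.HolderTriple q (ENNReal.ofReal (d / 2)) 1 := by
        constructor
        rw [hval q hq, h3, ← ENNReal.ofReal_inv_of_pos hr0, ← ENNReal.ofReal_add
          (div_nonneg (by linarith) (by linarith)) (by positivity), inv_one,
          ← ENNReal.ofReal_one]
        congr 1
        field_simp
        ring
      obtain ⟨K', hK'⟩ := hK.evalBound_of_dual hr hμ hlam hz
      refine not_evalBound_half_dim hd3 ?_ ENNReal.ofReal_ne_top
        (ENNReal.toReal_ofReal hr0.le) hK'
      rw [← ENNReal.ofReal_one]
      exact ENNReal.ofReal_le_ofReal (by linarith)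
    · have hq1 := htop h3
      subst hq1
      have hpt : p.toReal = d / 2 := by
        rw [← inv_inv p.toReal, ← ENNReal.toReal_inv, h1, inv_div]
      refine not_evalBound_half_dim hd3 hp ?_ hpt hK.evalBound
      intro h
      rw [h, ENNReal.toReal_top] at hpt
      linarith
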